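/- **Setting.** Fix $d\ge 2$. For $n\ge 0$ let $H=(H_1,\dots,H_n)$ be a polynomial map $\mathbb C^n\to\mathbb C^n$ with every $H_i$ homogeneous of degree $d$, written $H_i=\sum_{|\alpha|=d}\frac{H_{i,\alpha}}{\alpha!}X^\alpha$, let $L=\max_{i,\,|\alpha|=d}|H_{i,\alpha}|$, let $JH=(\partial H_i/\partial X_j)_{i,j}$, and let $F=I-H$. The map $F$ has a unique formal power series inverse at the origin (with $F^{-1}(0)=0$); let $g_{i,\alpha}$ denote the coefficient of $X^\alpha$ in $F_i^{-1}$. For $k\ge1$ and $|\alpha|=(d-1)k+1$ put $$B_{\alpha}(L)=\frac1{(d!)^k}\,\frac{1}{(d-1)k+1}\binom{dk}{k}\,n^{k-1}\,\frac{|\alpha|!}{\alpha!}\,L^k .$$ Let $\mathcal C_k^{(d)}$ be the (finite) set of rooted planar trees with $k$ internal vertices in which every vertex has $0$ or $d$ children. Given a tree $T\in\mathcal C_k^{(d)}$ and an ancestral path $(v_0,\dots,v_p)$ in $T$ (each $v_{l}$ a child of $v_{l-1}$), the associated length-$p$ shuffle class is the set of all trees obtained from $T$ by permuting, among their $(d-1)p$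 positions, the subtrees subtended by the siblings of $v_1,\dots,v_p$. For $f:\mathcal C_k^{(d)}\to\mathbb C$ put $\|f\|_1=\frac{1}{\#\mathcal C_k^{(d)}}\sum_{T}|f(T)|$, and let $\mathbf 1$ be the constant function $1$. **Theorem.** 1. For all such $H$, all $k\ge1$, all $i$ and all $\alpha$ with $|\alpha|=(d-1)k+1$: $|g_{i,\alpha}|\le B_\alpha(L)$. 2. This is sharp: for every $n\ge1$ and $L\ge0$ there is such an $H$ with $\max_{i,|\alpha|=d}|H_{i,\alpha}|=L$ for which $|g_{i,\alpha}|=B_\alpha(L)$ for all $k\ge 1$, all $i$ and all $\alpha$ with $|\alpha|=(d-1)k+1$. 3. If $(JH)^p=0$ for some $p\ge1$, then for all $k\ge1$, every $\phi$ in the complex linear span of the indicator functions of the length-$p$ shuffle classes of $\mathcal C^{(d)}_k$, all $i$ and all $\alpha$ with $|\alpha|=(d-1)k+1$: $|g_{i,\alpha}|\le B_\alpha(L)\,\|\phi-\mathbf 1\|_1$. 4. In particular, for every $p\ge1$ there are constants $C,c>0$ depending only on $d$ and $p$ such that for every $k\ge1$ some $\phi$ in that span satisfies $\|\phi-\mathbf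 1\|_1\le Ce^{-ck}$, and such that, for every $n$ and every such $H$ with $(JH)^p=0$, $|g_{i,\alpha}|\le B_\alpha(L)\,Ce^{-ck}$ for all $k\ge1$, all $i$ and all $\alpha$ with $|\alpha|=(d-1)k+1$. 5. Consequently, for every $n$ there are $C,c>0$ depending only on $d$ and $n$ such that, whenever $F=I-H$ is a Keller map ($\det JF$ is a nonzero constant), $|g_{i,\alpha}|\le B_\alpha(L)\,Ce^{-ck}$ for all $k\ge1$, all $i$ and all $\alpha$ with $|\alpha|=(d-1)k+1$. -/

import Mathlib

namespace KellerTree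

/-! ### Planar `d`-ary trees -/

/-- Rooted planar `d`-ary trees: every vertex is a leaf or has `d` linearly ordered children. -/
inductive DTree (d : ℕ) : Type
  | leaf : DTree d
  | node (children : Fin d → DTree d) : DTree d

/-- The number of internal (that is, non-leaf) vertices. -/
def DTree.numInternal {d : ℕ} : DTree d → ℕ
  | .leaf => 0
  | .node c => 1 + ∑ j, (c j).numInternal

/-- The set `𝒞_k^{(d)}` of `d`-Catalan trees with `k` internal vertices. -/
def CatalanTree (d k : ℕ) : Type := {T : DTree d // T.numInternal = k}

theorem DTree.finite_numInternal_le (d k : ℕ) :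
    {T : DTree d | T.numInternal ≤ k}.Finite := by
  induction k with
  | zero =>
    refine (Set.finite_singleton (DTree.leaf : DTree d)).subset ?_
    rintro (_ | c) hT
    · rfl
    · simp [DTree.numInternal] at hT
  | succ k ih =>
    have hpi : {c : Fin d → DTree d | ∀ j, (c j).numInternal ≤ k}.Finite := by
      have := Set.Finite.pi (ι := Fin d) (fun _ => ih)
      refine this.subset ?_
      intro c hc j _
      exact hc j
    refine ((hpi.image DTree.node).union (Set.finite_singleton DTree.leaf)).subset ?_
    rintro (_ | c) hT
    · exact Or.inr rfl
    · refine Or.inl ⟨c, fun j => ?_, rfl⟩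
      have h1 : (c j).numInternal ≤ ∑ j, (c j).numInternal :=
        Finset.single_le_sum (f := fun j => (c j).numInternal) (fun _ _ => Nat.zero_le _)
          (Finset.mem_univ j)
      simp only [DTree.numInternal, Set.mem_ofPred_eq] at hT
      omega

instance (d k : ℕ) : Finite (CatalanTree d k) :=
  ((DTree.finite_numInternal_le d k).subset
    (fun _ (hT : DTree.numInternal _ = k) => hT.le)).to_subtype

noncomputable instance (d k : ℕ) : Fintype (CatalanTree d k) := Fintype.ofFinite _

/-! ### Shuffle classes -/

/-- The positions of the siblings off a path `(v_0, …, v_p)`, where `v_{l+1}` is the child number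
`a l` of `v_l`: the position `(l, j)` with `j ≠ a l` is the child number `j` of `v_l`. There are
`(d - 1) p` of them. -/
abbrev Slot {d p : ℕ} (a : Fin p → Fin d) : Type := {s : Fin p × Fin d // s.2 ≠ a s.1}

/-- The tree whose root `v_0` starts a path `(v_0, …, v_p)` where `v_{l+1}` is the child number
`a l` of `v_l`, where the sibling at position `s` subtends the subtree `W s`, and where the last
vertex `v_p` subtends the subtree `B`. -/
def DTree.spine {d : ℕ} : {p : ℕ} → (a : Fin p → Fin d) → (W : Slot a → DTree d) →
    (B : DTree d) → DTree d
  | 0, _, _, B => B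
  | _ + 1, a, W, B => .node fun j =>
      if h : j = a 0 then
        DTree.spine (fun l => a l.succ) (fun s => W ⟨(s.1.1.succ, s.1.2), s.2⟩) B
      else W ⟨(0, j), h⟩

/-- Length-`p` shuffle classes in `𝒞_k^{(d)}`. A tree `T` with a length-`p` ancestral path
`(v_0, …, v_p)` is written as `T = spine u V (spine a W B)`: the first spine (of any length
`m ≥ 0`) is the path from the root to `v_0`, the second one is `(v_0, …, v_p)`. The shuffle class
`Sh(T; v_0, …, v_p)` consists of all the trees obtained by permuting the `(d - 1) p` subtrees
`W s` among the sibling positions of the path, across all generations. -/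
def IsShuffleClass {d k : ℕ} (p : ℕ) (S : Set (CatalanTree d k)) : Prop :=
  ∃ (m : ℕ) (u : Fin m → Fin d) (V : Slot u → DTree d)
    (a : Fin p → Fin d) (W : Slot a → DTree d) (B : DTree d),
    (DTree.spine u V (DTree.spine a W B)).numInternal = k ∧
    S = {T' | ∃ σ : Equiv.Perm (Slot a),
          T'.1 = DTree.spine u V (DTree.spine a (fun s => W (σ s)) B)}

/-- The linear span of the indicator functions of the length-`p` shuffle classes. -/
noncomputable def shuffleSpan (d k p : ℕ) : Submodule ℂ (CatalanTree d k → ℂ) :=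
  Submodule.span ℂ {f | ∃ S : Set (CatalanTree d k), IsShuffleClass p S ∧
    f = S.indicator (fun _ => (1 : ℂ))}

/-- The normalised norm `‖f‖₁ = (1 / #𝒞_k^{(d)}) ∑_T |f(T)|`. -/
noncomputable def norm1 {d k : ℕ} (f : CatalanTree d k → ℂ) : ℝ :=
  (∑ T, ‖f T‖) / (Fintype.card (CatalanTree d k) : ℝ)

/-! ### Polynomial maps and their inverses -/

/-- The map `F = I - H`. -/
noncomputable def idSub {n : ℕ} (H : Fin n → MvPolynomial (Fin n) ℂ) :
    Fin n → MvPolynomial (Fin n) ℂ :=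
  fun i => MvPolynomial.X i - H i

/-- The Jacobian matrix `(∂F_i / ∂X_j)_{i,j}`. -/
noncomputable def jacobian {n : ℕ} (F : Fin n → MvPolynomial (Fin n) ℂ) :
    Matrix (Fin n) (Fin n) (MvPolynomial (Fin n) ℂ) :=
  Matrix.of fun i j => MvPolynomial.pderiv j (F i)

/-- Keller maps: the Jacobian determinant is a nonzero constant. -/
def IsKeller {n : ℕ} (F : Fin n → MvPolynomial (Fin n) ℂ) : Prop :=
  ∃ c : ℂ, c ≠ 0 ∧ (jacobian F).det = MvPolynomial.C c

/-- `G` is the formal power series inverse of `F` at the origin: `G(0) = 0`, `F ∘ G = I` and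
`G ∘ F = I` (used for `F` with `F(0) = 0`, where the second substitution is well defined). -/
def IsInverse {n : ℕ} (F : Fin n → MvPolynomial (Fin n) ℂ)
    (G : Fin n → MvPowerSeries (Fin n) ℂ) : Prop :=
  (∀ i, MvPowerSeries.constantCoeff (G i) = 0) ∧
  (∀ i, MvPolynomial.aeval G (F i) = MvPowerSeries.X i) ∧
  (∀ i, MvPowerSeries.subst (fun j => (F j : MvPowerSeries (Fin n) ℂ)) (G i)
    = (MvPowerSeries.X i : MvPowerSeries (Fin n) ℂ))

/-- `α! = α_1! ⋯ α_n!`. -/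
def multiFactorial {n : ℕ} (α : Fin n →₀ ℕ) : ℕ := ∏ i, (α i).factorial

/-- The coefficient `H_{i,α}` in `H_i = ∑_α (H_{i,α} / α!) X^α`. -/
noncomputable def hcoeff {n : ℕ} (H : Fin n → MvPolynomial (Fin n) ℂ) (i : Fin n)
    (α : Fin n →₀ ℕ) : ℂ :=
  (multiFactorial α : ℂ) * (H i).coeff α

/-- `L = max |H_{i,α}|`, over all `i` and all multi-indices with `|α| = d`. -/
noncomputable def maxCoeff {n : ℕ} (d : ℕ) (H : Fin n → MvPolynomial (Fin n) ℂ) : NNReal :=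
  (Finset.univ ×ˢ Finset.finsuppAntidiag (Finset.univ : Finset (Fin n)) d).sup
    fun q => ‖hcoeff H q.1 q.2‖₊

/-- `(1/(d!)^k) (1/((d-1)k+1)) binom(dk,k) n^{k-1} (|α|!/α!) L^k`, for `k ≥ 1`. -/
noncomputable def coeffBound (d n k : ℕ) (α : Fin n →₀ ℕ) (L : ℝ) : ℝ :=
  1 / ((d.factorial : ℝ) ^ k) * (1 / (((d : ℝ) - 1) * k + 1)) * ((d * k).choose k : ℝ)
    * (n : ℝ) ^ (k - 1) * ((α.degree.factorial : ℝ) / (multiFactorial α : ℝ)) * L ^ k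

end KellerTree

namespace KellerTree

/-! ### Trees of bounded height -/

open Classical in
/-- The `d`-ary trees all of whose root-to-leaf paths have fewer than `h` edges. -/
noncomputable def treesUpTo (d : ℕ) : ℕ → Finset (DTree d)
  | 0 => ∅
  | h + 1 => insert DTree.leaf
      ((Fintype.piFinset fun _ : Fin d => treesUpTo d h).image DTree.node)

theorem leaf_mem_treesUpTo (d h : ℕ) : (DTree.leaf : DTree d) ∈ treesUpTo d (h + 1) := by
  simp [treesUpTo]

theorem node_mem_treesUpTo {d h : ℕ} (c : Fin d → DTree d) :
    DTree.node c ∈ treesUpTo d (h + 1) ↔ ∀ j, c j ∈ treesUpTo d h := by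
  simp [treesUpTo]

theorem mem_treesUpTo_of_numInternal_lt {d : ℕ} (h : ℕ) :
    ∀ T : DTree d, T.numInternal < h → T ∈ treesUpTo d h := by
  induction h with
  | zero => intro T hT; omega
  | succ h ih =>
    rintro (_ | c) hT
    · exact leaf_mem_treesUpTo d h
    · rw [node_mem_treesUpTo]
      intro j
      have h1 : (c j).numInternal ≤ ∑ j, (c j).numInternal :=
        Finset.single_le_sum (f := fun j => (c j).numInternal) (fun _ _ => Nat.zero_le _)
          (Finset.mem_univ j)
      simp only [DTree.numInternal] at hT
      exact ih _ (by omega)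

theorem sum_treesUpTo_succ {A : Type*} [AddCommMonoid A] (d h : ℕ) (f : DTree d → A) :
    ∑ T ∈ treesUpTo d (h + 1), f T
      = f DTree.leaf + ∑ c ∈ Fintype.piFinset (fun _ : Fin d => treesUpTo d h),
          f (DTree.node c) := by
  classical
  rw [treesUpTo, Finset.sum_insert (by simp), Finset.sum_image]
  intro c _ c' _ hcc
  exact DTree.node.inj hcc

/-- Sums over `𝒞_k^{(d)}` as sums over trees of bounded height. -/
theorem sum_catalanTree {A : Type*} [AddCommMonoid A] {d k h : ℕ} (hk : k < h)
    (f : DTree d → A) (hf : ∀ T, T.numInternal ≠ k → f T = 0) :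
    ∑ T : CatalanTree d k, f T.1 = ∑ T ∈ treesUpTo d h, f T := by
  classical
  rw [← Finset.sum_filter_of_ne (p := fun T => T.numInternal = k)
    (fun T _ hT => by_contra fun h' => hT (hf T h'))]
  refine Finset.sum_bij (fun T _ => T.1) ?_ ?_ ?_ ?_
  · intro T _
    simp only [Finset.mem_filter]
    exact ⟨mem_treesUpTo_of_numInternal_lt h _ (by rw [T.2]; exact hk), T.2⟩
  · intro T _ T' _ hTT
    exact Subtype.ext hTT
  · intro T hT
    exact ⟨⟨T, (Finset.mem_filter.1 hT).2⟩, Finset.mem_univ _, rfl⟩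
  · intros; rfl

/-! ### The Fuss–Catalan numbers -/

/-- The generating function of the trees of bounded height. -/
noncomputable def truncSeries (d h : ℕ) : PowerSeries ℚ :=
  ∑ T ∈ treesUpTo d h, (PowerSeries.X : PowerSeries ℚ) ^ T.numInternal

/-- The generating function of `d`-ary trees. -/
noncomputable def treeSeries (d : ℕ) : PowerSeries ℚ :=
  PowerSeries.mk fun k => (Fintype.card (CatalanTree d k) : ℚ)

theorem truncSeries_succ (d h : ℕ) :
    truncSeries d (h + 1) = 1 + PowerSeries.X * truncSeries d h ^ d := by
  rw [truncSeries, sum_treesUpTo_succ]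
  congr 1
  have := Finset.prod_univ_sum (fun _ : Fin d => treesUpTo d h)
    (fun _ T => (PowerSeries.X : PowerSeries ℚ) ^ T.numInternal)
  rw [Finset.prod_const, Finset.card_univ, Fintype.card_fin] at this
  rw [truncSeries, this, Finset.mul_sum]
  refine Finset.sum_congr rfl fun c _ => ?_
  rw [Finset.prod_pow_eq_pow_sum, ← pow_succ', DTree.numInternal, add_comm]

theorem X_pow_dvd_treeSeries_sub (d h : ℕ) :
    (PowerSeries.X : PowerSeries ℚ) ^ h ∣ treeSeries d - truncSeries d h := by
  rw [PowerSeries.X_pow_dvd_iff]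
  intro k hk
  rw [map_sub, treeSeries, PowerSeries.coeff_mk, truncSeries, map_sum,
    ← sum_catalanTree hk (fun T => PowerSeries.coeff k ((PowerSeries.X : PowerSeries ℚ) ^
      T.numInternal))]
  · rw [Finset.sum_congr rfl (g := fun _ => (1 : ℚ))]
    · simp
    · intro T _
      simp [PowerSeries.coeff_X_pow, T.2]
  · intro T hT
    rw [PowerSeries.coeff_X_pow, if_neg hT.symm]

theorem treeSeries_eq (d : ℕ) :
    treeSeries d = 1 + PowerSeries.X * treeSeries d ^ d := by
  rw [← sub_eq_zero]
  ext k
  have h1 := X_pow_dvd_treeSeries_sub d (k + 1 + 1)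
  have h2 : (PowerSeries.X : PowerSeries ℚ) ^ (k + 1) ∣
      PowerSeries.X * (truncSeries d (k + 1) ^ d - treeSeries d ^ d) := by
    refine Dvd.dvd.mul_left ?_ _
    refine (dvd_trans ?_ (sub_dvd_pow_sub_pow _ _ d))
    rw [← neg_sub]
    exact (dvd_neg).2 (X_pow_dvd_treeSeries_sub d (k + 1))
  have h3 := dvd_add (dvd_trans (pow_dvd_pow _ (Nat.le_succ _)) h1) h2
  rw [truncSeries_succ] at h3
  have h4 : treeSeries d - (1 + PowerSeries.X * truncSeries d (k + 1) ^ d) +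
      PowerSeries.X * (truncSeries d (k + 1) ^ d - treeSeries d ^ d)
      = treeSeries d - (1 + PowerSeries.X * treeSeries d ^ d) := by ring
  rw [h4] at h3
  simpa using (PowerSeries.X_pow_dvd_iff.1 h3) k (Nat.lt_succ_self k)

theorem coeff_treeSeries_pow (d : ℕ) (hd : 1 ≤ d) (k r : ℕ) (h : 1 ≤ k + r) :
    PowerSeries.coeff k (treeSeries d ^ r)
      = (r : ℚ) / (d * k + r) * ((d * k + r).choose k : ℚ) := by
  induction k generalizing r with
  | zero =>
    have h0 : PowerSeries.constantCoeff (treeSeries d) = 1 := by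
      rw [treeSeries_eq]; simp
    have : (r : ℚ) ≠ 0 := by
      have : r ≠ 0 := by omega
      exact_mod_cast this
    simp [h0, this]
  | succ k ih =>
    induction r with
    | zero => simp [PowerSeries.coeff_one]
    | succ r ihr =>
      have e : treeSeries d ^ (r + 1)
          = treeSeries d ^ r + PowerSeries.X * treeSeries d ^ (r + d) := by
        linear_combination treeSeries d ^ r * treeSeries_eq d
      rw [e, map_add, PowerSeries.coeff_succ_X_mul, ihr (by omega), ih (r + d) (by omega)]
      have e1 : d * k + (r + d) = d * (k + 1) + r := by ring
      rw [e1, ← add_assoc (d * (k + 1)) r 1]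
      set N := d * (k + 1) + r with hN
      have hNk : k ≤ N := by
        have : 1 * (k + 1) ≤ d * (k + 1) := Nat.mul_le_mul_right _ hd
        omega
      have hN0 : (N : ℚ) ≠ 0 := by
        have : 1 * (k + 1) ≤ d * (k + 1) := Nat.mul_le_mul_right _ hd
        have : N ≠ 0 := by omega
        exact_mod_cast this
      have c1 : (N.choose (k + 1) : ℚ) * (k + 1) = N.choose k * (N - k) := by
        have := Nat.choose_succ_right_eq N k
        rw [← Nat.cast_sub hNk]
        exact_mod_cast this
      have c2 : ((N + 1).choose (k + 1) : ℚ) * (k + 1) = (N + 1) * N.choose k := by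
        have := Nat.add_one_mul_choose_eq N k
        exact_mod_cast this.symm
      have hk0 : (k + 1 : ℚ) ≠ 0 := by positivity
      have c1' : (N.choose (k + 1) : ℚ) = N.choose k * (N - k) / (k + 1) := by
        rw [eq_div_iff hk0, c1]
      have c2' : ((N + 1).choose (k + 1) : ℚ) = (N + 1) * N.choose k / (k + 1) := by
        rw [eq_div_iff hk0, c2]
      have hNq : (d : ℚ) * (k + 1) + r = N := by rw [hN]; push_cast; ring
      have hN1 : (N : ℚ) + 1 ≠ 0 := by positivity
      have a1 : (d : ℚ) * ((k + 1 : ℕ) : ℚ) + r = N := by rw [hN]; push_cast; ring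
      have a2 : (d : ℚ) * k + ((r + d : ℕ) : ℚ) = N := by rw [hN]; push_cast; ring
      have a3 : (d : ℚ) * ((k + 1 : ℕ) : ℚ) + ((r + 1 : ℕ) : ℚ) = N + 1 := by
        rw [hN]; push_cast; ring
      rw [a1, a2, a3, c1', c2']
      push_cast
      field_simp
      linear_combination (N.choose k : ℚ) * hNq

/-- The Fuss–Catalan formula for `#𝒞_k^{(d)}`. -/
theorem card_catalanTree (d : ℕ) (hd : 1 ≤ d) (k : ℕ) :
    (Fintype.card (CatalanTree d k) : ℝ)
      = 1 / (((d : ℝ) - 1) * k + 1) * ((d * k).choose k : ℝ) := by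
  have h := coeff_treeSeries_pow d hd k 1 (by omega)
  rw [pow_one, treeSeries, PowerSeries.coeff_mk] at h
  have h1 : (Fintype.card (CatalanTree d k) : ℝ)
      = 1 / (d * k + 1) * ((d * k + 1).choose k : ℝ) := by
    have := congrArg (fun q : ℚ => (q : ℝ)) h
    push_cast at this
    exact_mod_cast this
  have hle : k ≤ d * k := Nat.le_mul_of_pos_left k hd
  have h2 : ((d * k + 1).choose k : ℝ) * (((d : ℝ) - 1) * k + 1)
      = (d * k + 1) * ((d * k).choose k : ℝ) := by
    have := Nat.choose_mul_succ_eq (d * k) k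
    have e : ((d * k + 1 - k : ℕ) : ℝ) = ((d : ℝ) - 1) * k + 1 := by
      rw [Nat.cast_sub (by omega)]; push_cast; ring
    rw [← e, mul_comm ((d : ℝ) * k + 1)]
    exact_mod_cast this.symm
  have hd' : (1 : ℝ) ≤ d := by exact_mod_cast hd
  have p1 : ((d : ℝ) - 1) * k + 1 ≠ 0 := by
    have : 0 ≤ ((d : ℝ) - 1) * k := mul_nonneg (by linarith) (by positivity)
    linarith
  have p2 : (d : ℝ) * k + 1 ≠ 0 := by positivity
  rw [h1, one_div_mul_eq_div, one_div_mul_eq_div, div_eq_div_iff p2 p1, h2]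
  ring

/-! ### Spines -/

/-- Products over the siblings of a path, one generation at a time. -/
@[to_additive /-- Sums over the siblings of a path, one generation at a time. -/]
theorem prod_slot_succ {A : Type*} [CommMonoid A] {d p : ℕ} (a : Fin (p + 1) → Fin d)
    (f : Slot a → A) :
    ∏ s, f s = (∏ j, if h : j ≠ a 0 then f ⟨(0, j), h⟩ else 1)
      * ∏ s : Slot (fun l : Fin p => a l.succ), f ⟨(s.1.1.succ, s.1.2), s.2⟩ := by
  have key : ∀ (q : ℕ) (b : Fin q → Fin d) (g : Slot b → A),
      ∏ s, g s = ∏ l, ∏ j, if h : j ≠ b l then g ⟨(l, j), h⟩ else 1 := by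
    intro q b g
    rw [← Fintype.prod_prod_type'
      (fun l j => if h : j ≠ b l then g ⟨(l, j), h⟩ else 1)]
    rw [← Finset.prod_filter_of_ne (p := fun s : Fin q × Fin d => s.2 ≠ b s.1)
      (fun (s : Fin q × Fin d) _ hs h => hs (dif_neg (not_not.2 h))),
      Finset.prod_subtype (p := fun s : Fin q × Fin d => s.2 ≠ b s.1) _ (by simp)]
    exact Finset.prod_congr rfl fun s _ => by rw [dif_pos s.2]
  rw [key, key, Fin.prod_univ_succ]

theorem numInternal_spine {d : ℕ} : ∀ {p : ℕ} (a : Fin p → Fin d) (W : Slot a → DTree d)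
    (B : DTree d),
    (DTree.spine a W B).numInternal = p + (∑ s, (W s).numInternal + B.numInternal)
  | 0, a, W, B => by simp [DTree.spine]
  | p + 1, a, W, B => by
    rw [DTree.spine, DTree.numInternal, sum_slot_succ,
      ← Finset.add_sum_erase _ _ (Finset.mem_univ (a 0)), dif_pos rfl, numInternal_spine,
      ← Finset.add_sum_erase (f := fun j => if h : j ≠ a 0 then _ else 0) _
        (Finset.mem_univ (a 0)), dif_neg (by simp)]
    rw [Finset.sum_congr rfl (g := fun j => if h : j ≠ a 0 then
      (W ⟨(0, j), h⟩).numInternal else 0)]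
    · ring
    · intro j hj
      have := Finset.ne_of_mem_erase hj
      simp [this]

theorem spine_injective {d : ℕ} : ∀ {p : ℕ} (a : Fin p → Fin d) {W W' : Slot a → DTree d}
    {B B' : DTree d}, DTree.spine a W B = DTree.spine a W' B' → W = W' ∧ B = B'
  | 0, a, W, W', B, B', h => ⟨funext fun s => s.1.1.elim0, h⟩
  | p + 1, a, W, W', B, B', h => by
    have h1 := DTree.node.inj h
    have h0 := congrFun h1 (a 0)
    rw [dif_pos rfl, dif_pos rfl] at h0
    obtain ⟨hW, hB⟩ := spine_injective _ h0
    refine ⟨funext ?_, hB⟩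
    rintro ⟨⟨l, j⟩, hs⟩
    induction l using Fin.cases with
    | zero =>
      have h2 := congrFun h1 j
      simpa only [dif_neg (show ¬ j = a 0 from hs)] using h2
    | succ l => exact congrFun hW ⟨(l, j), hs⟩

/-- `Contains P T`: the tree `P` is the subtree subtended by some vertex of `T`. -/
inductive Contains {d : ℕ} (P : DTree d) : DTree d → Prop
  | refl : Contains P P
  | node (c : Fin d → DTree d) (j : Fin d) : Contains P (c j) → Contains P (.node c)

theorem Contains.numInternal_le {d : ℕ} {P T : DTree d} (h : Contains P T) :
    P.numInternal ≤ T.numInternal := by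
  induction h with
  | refl => exact le_rfl
  | node c j _ ih =>
    have h1 : (c j).numInternal ≤ ∑ j, (c j).numInternal :=
      Finset.single_le_sum (f := fun j => (c j).numInternal) (fun _ _ => Nat.zero_le _)
        (Finset.mem_univ j)
    simp only [DTree.numInternal]
    omega

theorem Contains.exists_spine {d : ℕ} {P T : DTree d} (h : Contains P T) :
    ∃ (m : ℕ) (u : Fin m → Fin d) (V : Slot u → DTree d), T = DTree.spine u V P := by
  induction h with
  | refl => exact ⟨0, Fin.elim0, fun s => s.1.1.elim0, rfl⟩
  | node c j _ ih =>
    obtain ⟨m, u, V, hV⟩ := ih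
    refine ⟨m + 1, Fin.cons j u, fun s => Fin.cases
      (motive := fun l => (j' : Fin d) → j' ≠ (Fin.cons j u : Fin (m + 1) → Fin d) l → DTree d)
      (fun j' _ => c j') (fun l j' h => V ⟨(l, j'), h⟩) s.1.1 s.1.2 s.2, ?_⟩
    rw [DTree.spine]
    congr 1
    funext j'
    by_cases hj : j' = j
    · subst hj
      rw [dif_pos (by simp)]
      exact hV
    · rw [dif_neg (by simpa using hj)]
      rfl

/-- The comb with `p` internal vertices: a path all of whose siblings are leaves. -/
def comb {d : ℕ} (j : Fin d) (p : ℕ) : DTree d :=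
  DTree.spine (fun _ : Fin p => j) (fun _ => .leaf) .leaf

theorem numInternal_comb {d : ℕ} (j : Fin d) (p : ℕ) : (comb j p).numInternal = p := by
  simp [comb, numInternal_spine, DTree.numInternal]

theorem isShuffleClass_singleton {d k p : ℕ} (j : Fin d) (T : CatalanTree d k)
    (h : Contains (comb j p) T.1) : IsShuffleClass p {T} := by
  obtain ⟨m, u, V, hV⟩ := h.exists_spine
  refine ⟨m, u, V, fun _ => j, fun _ => .leaf, .leaf, ?_, ?_⟩
  · rw [← T.2, hV]; rfl
  · ext T'
    simp only [Set.mem_singleton_iff, Set.mem_ofPred_eq, exists_const]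
    change T' = T ↔ T'.1 = DTree.spine u V (comb j p)
    rw [← hV]
    exact Subtype.ext_iff

theorem indicator_contains_mem_shuffleSpan {d : ℕ} (k p : ℕ) (j : Fin d) :
    {T : CatalanTree d k | Contains (comb j p) T.1}.indicator (fun _ => (1 : ℂ))
      ∈ shuffleSpan d k p := by
  classical
  have : {T : CatalanTree d k | Contains (comb j p) T.1}.indicator (fun _ => (1 : ℂ))
      = ∑ T ∈ Finset.univ.filter (fun T : CatalanTree d k => Contains (comb j p) T.1),
        ({T} : Set (CatalanTree d k)).indicator (fun _ => (1 : ℂ)) := by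
    funext T'
    rw [Finset.sum_apply]
    simp only [Set.indicator_apply, Set.mem_singleton_iff, Set.mem_ofPred_eq]
    rw [Finset.sum_ite_eq]
    simp
  rw [this]
  refine Submodule.sum_mem _ fun T hT => Submodule.subset_span ⟨{T}, ?_, rfl⟩
  exact isShuffleClass_singleton j T (Finset.mem_filter.1 hT).2

/-! ### Trees avoiding a fixed subtree -/

/-- The generating function at `x` of the trees of bounded height, by its recursion. -/
noncomputable def heightGen (d : ℕ) : ℕ → ℝ → ℝ
  | 0, _ => 0
  | h + 1, x => 1 + x * heightGen d h x ^ d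

theorem continuous_heightGen (d h : ℕ) : Continuous (heightGen d h) := by
  induction h with
  | zero => exact continuous_const
  | succ h ih => exact continuous_const.add (continuous_id.mul (ih.pow d))

open Classical in
/-- The generating function at `x` of the trees of bounded height without a subtree `P`. -/
noncomputable def avoidGen {d : ℕ} (P : DTree d) (h : ℕ) (x : ℝ) : ℝ :=
  ∑ T ∈ (treesUpTo d h).filter (fun T => ¬ Contains P T), x ^ T.numInternal

theorem avoidGen_nonneg {d : ℕ} (P : DTree d) (h : ℕ) {x : ℝ} (hx : 0 ≤ x) :
    0 ≤ avoidGen P h x :=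
  Finset.sum_nonneg fun _ _ => pow_nonneg hx _

open Classical in
theorem avoidGen_succ_le_sum {d : ℕ} (P : DTree d) (h : ℕ) {x : ℝ} (hx : 0 ≤ x)
    (s : Finset (Fin d → DTree d))
    (hs : ∀ c, (∀ j, c j ∈ treesUpTo d h) → ¬ Contains P (.node c) → c ∈ s) :
    avoidGen P (h + 1) x ≤ 1 + ∑ c ∈ s, x ^ (DTree.node c).numInternal := by
  have : (treesUpTo d (h + 1)).filter (fun T => ¬ Contains P T)
      ⊆ insert DTree.leaf (s.image DTree.node) := by
    rintro (_ | c) hT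
    · simp
    · rw [Finset.mem_filter, node_mem_treesUpTo] at hT
      simpa using hs c hT.1 hT.2
  refine (Finset.sum_le_sum_of_subset_of_nonneg this fun _ _ _ => pow_nonneg hx _).trans ?_
  rw [Finset.sum_insert (by simp), Finset.sum_image (fun c _ c' _ hcc => DTree.node.inj hcc)]
  simp [DTree.numInternal]

open Classical in
theorem sum_piFinset_avoid {d : ℕ} (P : DTree d) (h : ℕ) (x : ℝ) :
    ∑ c ∈ Fintype.piFinset (fun _ : Fin d => (treesUpTo d h).filter (fun T => ¬ Contains P T)),
      x ^ (DTree.node c).numInternal = x * avoidGen P h x ^ d := by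
  have := Finset.prod_univ_sum
    (fun _ : Fin d => (treesUpTo d h).filter (fun T => ¬ Contains P T))
    (fun _ T => x ^ T.numInternal)
  rw [Finset.prod_const, Finset.card_univ, Fintype.card_fin] at this
  rw [avoidGen, this, Finset.mul_sum]
  refine Finset.sum_congr rfl fun c _ => ?_
  rw [Finset.prod_pow_eq_pow_sum, ← pow_succ', DTree.numInternal, add_comm]

theorem avoidGen_succ_le {d : ℕ} (P : DTree d) (h : ℕ) {x : ℝ} (hx : 0 ≤ x) :
    avoidGen P (h + 1) x ≤ 1 + x * avoidGen P h x ^ d := by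
  classical
  rw [← sum_piFinset_avoid]
  refine avoidGen_succ_le_sum P h hx _ fun c hc hP => ?_
  rw [Fintype.mem_piFinset]
  exact fun j => Finset.mem_filter.2 ⟨hc j, fun hj => hP (.node c j hj)⟩

theorem avoidGen_succ_le_sub {d p : ℕ} (P : DTree d) (hP : P.numInternal = p + 1) (h : ℕ)
    (hh : p + 1 ≤ h) {x : ℝ} (hx : 0 ≤ x) :
    avoidGen P (h + 1) x ≤ 1 + x * avoidGen P h x ^ d - x ^ (p + 1) := by
  classical
  rcases P with _ | c
  · simp [DTree.numInternal] at hP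
  have hlt : ∀ j, (c j).numInternal < p + 1 := by
    intro j
    have h1 : (c j).numInternal ≤ ∑ j, (c j).numInternal :=
      Finset.single_le_sum (f := fun j => (c j).numInternal) (fun _ _ => Nat.zero_le _)
        (Finset.mem_univ j)
    simp only [DTree.numInternal] at hP
    omega
  rw [← sum_piFinset_avoid, ← Finset.sum_erase_add _ _ (a := c), hP, ← add_assoc,
    add_sub_cancel_right]
  · refine avoidGen_succ_le_sum _ h hx _ fun c' hc hP => ?_
    rw [Finset.mem_erase, Fintype.mem_piFinset]
    refine ⟨?_, fun j => Finset.mem_filter.2 ⟨hc j, fun hj => hP (.node c' j hj)⟩⟩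
    rintro rfl
    exact hP .refl
  · rw [Fintype.mem_piFinset]
    refine fun j => Finset.mem_filter.2 ⟨mem_treesUpTo_of_numInternal_lt h _
      ((hlt j).trans_le hh), fun hj => ?_⟩
    have := hj.numInternal_le
    have := hlt j
    omega

theorem avoidGen_le_heightGen {d : ℕ} (P : DTree d) (h : ℕ) {x : ℝ} (hx : 0 ≤ x) :
    avoidGen P h x ≤ heightGen d h x := by
  induction h with
  | zero => simp [avoidGen, treesUpTo, heightGen]
  | succ h ih =>
    refine (avoidGen_succ_le P h hx).trans ?_
    rw [heightGen]
    have := avoidGen_nonneg P h hx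
    gcongr

/-- The radius of convergence of the generating function of `d`-ary trees. -/
noncomputable def treeRadius (d : ℕ) : ℝ := ((d : ℝ) - 1) ^ (d - 1) / (d : ℝ) ^ d

theorem treeRadius_pos {d : ℕ} (hd : 2 ≤ d) : 0 < treeRadius d := by
  have : (2 : ℝ) ≤ d := by exact_mod_cast hd
  have : 0 < (d : ℝ) - 1 := by linarith
  unfold treeRadius
  positivity

theorem one_add_treeRadius_mul {d : ℕ} (hd : 2 ≤ d) :
    1 + treeRadius d * ((d : ℝ) / (d - 1)) ^ d = d / (d - 1) := by
  have h2 : (2 : ℝ) ≤ d := by exact_mod_cast hd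
  have h1 : (d : ℝ) - 1 ≠ 0 := by linarith
  have h0 : (d : ℝ) ≠ 0 := by linarith
  obtain ⟨e, rfl⟩ : ∃ e, d = e + 1 := ⟨d - 1, by omega⟩
  rw [treeRadius, div_pow, Nat.add_sub_cancel, pow_succ ((_ : ℝ) - 1)]
  field_simp
  ring

theorem heightGen_treeRadius_lt {d : ℕ} (hd : 2 ≤ d) (h : ℕ) :
    0 ≤ heightGen d h (treeRadius d) ∧ heightGen d h (treeRadius d) < d / (d - 1) := by
  have h2 : (2 : ℝ) ≤ d := by exact_mod_cast hd
  have h1 : 0 < (d : ℝ) - 1 := by linarith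
  have hr := treeRadius_pos hd
  induction h with
  | zero => exact ⟨le_rfl, by rw [heightGen]; positivity⟩
  | succ h ih =>
    refine ⟨?_, ?_⟩
    · rw [heightGen]
      have := ih.1
      positivity
    · rw [heightGen]
      conv_rhs => rw [← one_add_treeRadius_mul hd]
      have := pow_lt_pow_left₀ ih.2 ih.1 (by omega : d ≠ 0)
      gcongr

/-- The generating function of the trees without a given subtree converges beyond
`treeRadius d`. -/
theorem exists_avoidGen_bounded {d p : ℕ} (hd : 2 ≤ d) (P : DTree d)
    (hP : P.numInternal = p + 1) :
    ∃ x, treeRadius d < x ∧ ∀ h, avoidGen P h x ≤ d / (d - 1) := by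
  have hr := treeRadius_pos hd
  have c1 : ∀ᶠ x in nhds (treeRadius d), ∀ h ∈ Finset.range (p + 2),
      heightGen d h x < d / (d - 1) :=
    (Filter.eventually_all_finset _).2 fun h _ =>
      (continuous_heightGen d h).continuousAt.eventually_lt continuousAt_const
        (heightGen_treeRadius_lt hd h).2
  have c2 : ∀ᶠ x in nhds (treeRadius d),
      1 + x * ((d : ℝ) / (d - 1)) ^ d - x ^ (p + 1) < d / (d - 1) := by
    refine ContinuousAt.eventually_lt (f := fun x : ℝ =>
      1 + x * ((d : ℝ) / (d - 1)) ^ d - x ^ (p + 1)) (by fun_prop) continuousAt_const ?_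
    have := one_add_treeRadius_mul hd
    have := pow_pos hr (p + 1)
    linarith
  obtain ⟨x, ⟨h1, h2⟩, hx⟩ :=
    (((c1.and c2).filter_mono nhdsWithin_le_nhds).and
      (self_mem_nhdsWithin (s := Set.Ioi (treeRadius d)))).exists
  have hx0 : 0 ≤ x := hr.le.trans (le_of_lt hx)
  refine ⟨x, hx, fun h => ?_⟩
  have small : ∀ h ≤ p + 1, avoidGen P h x ≤ d / (d - 1) := fun h hh =>
    (avoidGen_le_heightGen P _ hx0).trans (h1 h (Finset.mem_range.2 (by omega))).le
  rcases le_total h (p + 1) with hh | hh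
  · exact small h hh
  · induction h, hh using Nat.le_induction with
    | base => exact small _ le_rfl
    | succ h hh ih =>
      refine (avoidGen_succ_le_sub P hP h hh hx0).trans (le_trans ?_ h2.le)
      have := avoidGen_nonneg P h hx0
      gcongr

/-- The largest term in the binomial expansion of `(1 + (d - 1)) ^ (d * k)` is the one with
index `k`. -/
theorem choose_mul_pow_le {d k : ℕ} (hd : 2 ≤ d) (j : ℕ) :
    (d * k).choose j * (d - 1) ^ (d * k - j) ≤ (d * k).choose k * (d - 1) ^ (d * k - k) := by
  obtain ⟨e, rfl⟩ : ∃ e, d = e + 1 := ⟨d - 1, by omega⟩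
  rw [Nat.add_sub_cancel]
  set N := (e + 1) * k with hN
  have hNk : N = e * k + k := by rw [hN]; ring
  rcases le_total j k with h | h
  · obtain ⟨m, hm⟩ := Nat.exists_eq_add_of_le h
    induction m generalizing j with
    | zero => rw [hm, Nat.add_zero]
    | succ m ih =>
      refine le_trans ?_ (ih (j + 1) (by omega) (by omega))
      have e1 : N - j = (N - (j + 1)) + 1 := by
        have : k ≤ N := by omega
        omega
      rw [e1, pow_succ', ← mul_assoc]
      refine Nat.mul_le_mul_right _ (Nat.le_of_mul_le_mul_right ?_ (Nat.succ_pos j))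
      rw [Nat.succ_eq_add_one, Nat.choose_succ_right_eq, mul_assoc]
      refine Nat.mul_le_mul_left _ ?_
      have : e * (j + 1) ≤ e * k := Nat.mul_le_mul_left _ (by omega)
      omega
  · induction j, h using Nat.le_induction with
    | base => exact le_rfl
    | succ j h ih =>
      refine le_trans ?_ ih
      rcases Nat.lt_or_ge N (j + 1) with hj | hj
      · simp [Nat.choose_eq_zero_of_lt hj]
      have e1 : N - j = (N - (j + 1)) + 1 := by omega
      rw [e1, pow_succ', ← mul_assoc]
      refine Nat.mul_le_mul_right _ (Nat.le_of_mul_le_mul_right ?_ (Nat.succ_pos j))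
      rw [Nat.succ_eq_add_one, Nat.choose_succ_right_eq, mul_assoc]
      refine Nat.mul_le_mul_left _ ?_
      have : e * k ≤ e * (j + 1) := Nat.mul_le_mul_left _ (by omega)
      omega

theorem one_le_card_mul_treeRadius_pow {d : ℕ} (hd : 2 ≤ d) (k : ℕ) :
    1 ≤ (Fintype.card (CatalanTree d k) : ℝ) * (d * k + 1) ^ 2 * treeRadius d ^ k := by
  have h2 : (2 : ℝ) ≤ d := by exact_mod_cast hd
  have h1 : 0 < (d : ℝ) - 1 := by linarith
  have hsum : d ^ (d * k) ≤ (d * k + 1) * ((d * k).choose k * (d - 1) ^ (d * k - k)) := by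
    have h := add_pow 1 (d - 1) (d * k)
    rw [show 1 + (d - 1) = d by omega] at h
    rw [h]
    refine (Finset.sum_le_card_nsmul _ _ ((d * k).choose k * (d - 1) ^ (d * k - k)) ?_).trans
      (by simp)
    intro j _
    rw [one_pow, one_mul, mul_comm]
    exact choose_mul_pow_le hd j
  have hsum' : (d : ℝ) ^ (d * k)
      ≤ (d * k + 1) * ((d * k).choose k * ((d : ℝ) - 1) ^ ((d - 1) * k)) := by
    rw [Nat.sub_mul, one_mul]
    have := (Nat.cast_le (α := ℝ)).2 hsum
    push_cast [Nat.cast_sub (show 1 ≤ d by omega)] at this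
    exact this
  have hpos : 0 < ((d : ℝ) - 1) * k + 1 := by positivity
  rw [card_catalanTree d (by omega), treeRadius, div_pow, ← pow_mul, ← pow_mul]
  calc (1 : ℝ) = d ^ (d * k) / d ^ (d * k) := (div_self (by positivity)).symm
    _ ≤ (d * k + 1) * ((d * k).choose k * ((d : ℝ) - 1) ^ ((d - 1) * k)) / d ^ (d * k) := by
        gcongr
    _ = 1 * ((d * k + 1) * ((d * k).choose k * ((d : ℝ) - 1) ^ ((d - 1) * k)) / d ^ (d * k)) :=
        (one_mul _).symm
    _ ≤ ((d * k + 1) / (((d : ℝ) - 1) * k + 1)) *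
          ((d * k + 1) * ((d * k).choose k * ((d : ℝ) - 1) ^ ((d - 1) * k)) / d ^ (d * k)) := by
        refine mul_le_mul_of_nonneg_right ?_ (by positivity)
        rw [one_le_div hpos]
        have : (0 : ℝ) ≤ k := by positivity
        nlinarith
    _ = _ := by field_simp

open Classical in
theorem norm1_indicator_sub_one {d k : ℕ} (P : CatalanTree d k → Prop) :
    norm1 (fun T => {T | P T}.indicator (fun _ => (1 : ℂ)) T - 1)
      = ((Finset.univ.filter fun T => ¬ P T).card : ℝ) / Fintype.card (CatalanTree d k) := by
  rw [norm1, Finset.card_filter, Nat.cast_sum]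
  congr 1
  refine Finset.sum_congr rfl fun T _ => ?_
  by_cases h : P T <;> simp [h]

open Classical in
theorem card_avoid_mul_pow_le {d : ℕ} (P : DTree d) (k : ℕ) {x : ℝ} (hx : 0 ≤ x) :
    ((Finset.univ.filter fun T : CatalanTree d k => ¬ Contains P T.1).card : ℝ) * x ^ k
      ≤ avoidGen P (k + 1) x := by
  rw [Finset.card_filter, Nat.cast_sum, Finset.sum_mul, avoidGen, Finset.sum_filter]
  have h := sum_catalanTree (d := d) (Nat.lt_succ_self k)
    (fun T => if T.numInternal = k ∧ ¬ Contains P T then x ^ k else 0)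
    (fun T hT => if_neg fun h => hT h.1)
  calc _ = ∑ T : CatalanTree d k,
        (if T.1.numInternal = k ∧ ¬ Contains P T.1 then x ^ k else 0) := by
        refine Finset.sum_congr rfl fun T _ => ?_
        have := T.2
        by_cases hT : Contains P T.1 <;> simp [hT, this]
    _ ≤ _ := by
        rw [h]
        refine Finset.sum_le_sum fun T _ => ?_
        have := pow_nonneg hx T.numInternal
        split_ifs with h1 h2 h2
        · exact absurd h2 h1.2
        · rw [h1.1]
        · exact le_rfl
        · exact this

/-- The constant function `1` is exponentially close to the span of the shuffle indicators. -/
theorem exists_mem_shuffleSpan_norm1_le {d p : ℕ} (hd : 2 ≤ d) (hp : 1 ≤ p) :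
    ∃ C c : ℝ, 0 < C ∧ 0 < c ∧ ∀ k : ℕ, 1 ≤ k → ∃ φ ∈ shuffleSpan d k p,
      norm1 (fun T => φ T - 1) ≤ C * Real.exp (-c * k) := by
  classical
  obtain ⟨q, rfl⟩ : ∃ q, p = q + 1 := ⟨p - 1, by omega⟩
  have j : Fin d := ⟨0, by omega⟩
  obtain ⟨x, hx, hb⟩ := exists_avoidGen_bounded hd (comb j (q + 1)) (numInternal_comb j (q + 1))
  have hr := treeRadius_pos hd
  have hx0 : 0 < x := hr.trans hx
  have hd2 : (2 : ℝ) ≤ d := by exact_mod_cast hd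
  have hd1 : 0 < (d : ℝ) - 1 := by linarith
  set y : ℝ := Real.log (x / treeRadius d) / 2 with hy
  have hy0 : 0 < y := by
    have : 0 < Real.log (x / treeRadius d) := Real.log_pos ((one_lt_div hr).2 hx)
    positivity
  have hexp : Real.exp (-y) < 1 := by simpa using hy0
  have hexp2 : treeRadius d / x = Real.exp (-y) * Real.exp (-y) := by
    rw [← Real.exp_add, show -y + -y = -Real.log (x / treeRadius d) by rw [hy]; ring,
      Real.exp_neg, Real.exp_log (by positivity), inv_div]
  obtain ⟨M, hM⟩ := (tendsto_pow_const_mul_const_pow_of_lt_one 2 (Real.exp_pos (-y)).le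
    hexp).bddAbove_range
  have hM' : ∀ k : ℕ, (k : ℝ) ^ 2 * Real.exp (-y) ^ k ≤ |M| := fun k =>
    (hM ⟨k, rfl⟩).trans (le_abs_self M)
  refine ⟨d / (d - 1) * ((d + 1) ^ 2 * (|M| + 1)), y, by positivity, hy0, fun k hk =>
    ⟨_, indicator_contains_mem_shuffleSpan k (q + 1) j, ?_⟩⟩
  rw [norm1_indicator_sub_one]
  have hk1 : (1 : ℝ) ≤ k := by exact_mod_cast hk
  have hcard := one_le_card_mul_treeRadius_pow hd k
  have hA := (card_avoid_mul_pow_le (comb j (q + 1)) k hx0.le).trans (hb (k + 1))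
  set a : ℝ := ((Finset.univ.filter fun T : CatalanTree d k =>
    ¬ Contains (comb j (q + 1)) T.1).card : ℝ)
  set b : ℝ := (Fintype.card (CatalanTree d k) : ℝ)
  have hb0 : 0 < b := by
    by_contra hb0
    have : b ≤ 0 := not_lt.1 hb0
    have := mul_nonpos_of_nonpos_of_nonneg this
      (show 0 ≤ (d * k + 1 : ℝ) ^ 2 * treeRadius d ^ k by positivity)
    rw [← mul_assoc] at this
    linarith
  have e1 : Real.exp (-y * k) = Real.exp (-y) ^ k := by
    rw [← Real.exp_nat_mul, mul_comm]
  have e2 : treeRadius d ^ k = x ^ k * (Real.exp (-y) ^ k * Real.exp (-y) ^ k) := by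
    rw [← mul_pow, ← hexp2, ← mul_pow, mul_div_cancel₀ _ hx0.ne']
  rw [div_le_iff₀ hb0, e1]
  set r := Real.exp (-y) ^ k
  have hr0 : 0 ≤ r := by positivity
  have ha0 : 0 ≤ a := by positivity
  calc a = a * 1 := (mul_one a).symm
    _ ≤ a * (b * (d * k + 1) ^ 2 * treeRadius d ^ k) := by gcongr
    _ = (a * x ^ k) * (((d * k + 1) ^ 2 * r) * (r * b)) := by rw [e2]; ring
    _ ≤ (d / (d - 1)) * ((((d + 1) * k) ^ 2 * r) * (r * b)) := by
        gcongr
        nlinarith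
    _ = (d / (d - 1)) * ((d + 1) ^ 2 * (k ^ 2 * r) * (r * b)) := by ring
    _ ≤ (d / (d - 1)) * ((d + 1) ^ 2 * (|M| + 1) * (r * b)) := by
        have := hM' k
        gcongr
        linarith
    _ = _ := by ring

/-! ### Symmetric coefficients -/

/-- The exponent of the monomial `∏ l, X (j l)`. -/
noncomputable def expo {d n : ℕ} (j : Fin d → Fin n) : Fin n →₀ ℕ :=
  ∑ l, Finsupp.single (j l) 1

theorem prod_X_eq {R : Type*} [CommSemiring R] {d n : ℕ} (j : Fin d → Fin n) :
    ∏ l, (MvPolynomial.X (j l) : MvPolynomial (Fin n) R) = MvPolynomial.monomial (expo j) 1 := by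
  rw [expo, MvPolynomial.monomial_sum_one]
  rfl

theorem degree_expo {d n : ℕ} (j : Fin d → Fin n) : (expo j).degree = d := by
  simp [expo, map_sum]

theorem multiFactorial_ne_zero {n : ℕ} (α : Fin n →₀ ℕ) : multiFactorial α ≠ 0 :=
  Finset.prod_ne_zero_iff.2 fun _ _ => Nat.factorial_ne_zero _

theorem coeff_sum_X_pow {R : Type*} [Field R] [CharZero R] {n : ℕ} (α : Fin n →₀ ℕ) (m : ℕ) :
    MvPolynomial.coeff α ((∑ i, MvPolynomial.X i : MvPolynomial (Fin n) R) ^ m)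
      = if α.degree = m then (α.degree.factorial : R) / multiFactorial α else 0 := by
  rw [MvPolynomial.coeff_sum_X_pow_of_fintype]
  have e : (α.sum fun _ m => m) = α.degree := rfl
  rw [e]
  split_ifs
  · rw [eq_div_iff (by exact_mod_cast multiFactorial_ne_zero α), mul_comm]
    rw [Finsupp.multinomial_eq_of_support_subset (Finset.subset_univ _), multiFactorial,
      Finsupp.degree_eq_sum]
    exact_mod_cast Nat.multinomial_spec Finset.univ α
  · exact Nat.cast_zero

/-- The coefficients of the symmetric `d`-linear form attached to `H_i`. -/
noncomputable def symCoeff {n : ℕ} (d : ℕ) (H : Fin n → MvPolynomial (Fin n) ℂ) (i : Fin n)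
    (j : Fin d → Fin n) : ℂ :=
  hcoeff H i (expo j) / d.factorial

theorem symCoeff_comp_perm {n d : ℕ} (H : Fin n → MvPolynomial (Fin n) ℂ) (i : Fin n)
    (j : Fin d → Fin n) (σ : Equiv.Perm (Fin d)) :
    symCoeff d H i (j ∘ σ) = symCoeff d H i j := by
  have : expo (j ∘ σ) = expo j :=
    Equiv.sum_comp σ (fun l => (Finsupp.single (j l) 1 : Fin n →₀ ℕ))
  rw [symCoeff, symCoeff, this]

theorem eq_sum_symCoeff {n d : ℕ} {H : Fin n → MvPolynomial (Fin n) ℂ}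
    (hH : ∀ i, (H i).IsHomogeneous d) (i : Fin n) :
    H i = ∑ j : Fin d → Fin n, symCoeff d H i j • ∏ l, MvPolynomial.X (j l) := by
  ext α
  have h1 := coeff_sum_X_pow (R := ℂ) α d
  rw [Fintype.sum_pow, MvPolynomial.coeff_sum] at h1
  simp_rw [prod_X_eq, MvPolynomial.coeff_monomial] at h1
  have h2 : MvPolynomial.coeff α
      (∑ j : Fin d → Fin n, symCoeff d H i j • ∏ l, MvPolynomial.X (j l))
      = hcoeff H i α / d.factorial
        * ∑ j : Fin d → Fin n, if expo j = α then (1 : ℂ) else 0 := by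
    rw [MvPolynomial.coeff_sum, Finset.mul_sum]
    refine Finset.sum_congr rfl fun j _ => ?_
    rw [MvPolynomial.coeff_smul, prod_X_eq, MvPolynomial.coeff_monomial, symCoeff]
    split_ifs with h
    · rw [h, smul_eq_mul]
    · simp
  rw [h2, h1]
  have m0 : (multiFactorial α : ℂ) ≠ 0 := by exact_mod_cast multiFactorial_ne_zero α
  split_ifs with h
  · have f0 : (d.factorial : ℂ) ≠ 0 := by exact_mod_cast d.factorial_ne_zero
    rw [h, hcoeff]
    field_simp
  · rw [mul_zero, (hH i).coeff_eq_zero h]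

theorem aeval_eq_sum_symCoeff {n d : ℕ} {H : Fin n → MvPolynomial (Fin n) ℂ}
    (hH : ∀ i, (H i).IsHomogeneous d) {A : Type*} [CommRing A] [Algebra ℂ A] (x : Fin n → A)
    (i : Fin n) :
    MvPolynomial.aeval x (H i) = ∑ j : Fin d → Fin n, symCoeff d H i j • ∏ l, x (j l) := by
  conv_lhs => rw [eq_sum_symCoeff hH i]
  simp [map_sum, map_prod]

theorem norm_symCoeff_le {n d : ℕ} (H : Fin n → MvPolynomial (Fin n) ℂ) (i : Fin n)
    (j : Fin d → Fin n) : ‖symCoeff d H i j‖ ≤ maxCoeff d H / d.factorial := by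
  rw [symCoeff, norm_div, Complex.norm_natCast]
  gcongr
  have : ‖hcoeff H i (expo j)‖₊ ≤ maxCoeff d H := by
    refine Finset.le_sup (f := fun q : Fin n × (Fin n →₀ ℕ) => ‖hcoeff H q.1 q.2‖₊)
      (b := (i, expo j)) ?_
    rw [Finset.mem_product, Finset.mem_finsuppAntidiag]
    refine ⟨Finset.mem_univ _, ?_, Finset.subset_univ _⟩
    rw [← Finsupp.degree_eq_sum, degree_expo]
  exact_mod_cast this

/-! ### Weights of trees -/

/-- The sum, over all labellings of the vertices of a tree with root labelled `i`, of the products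
of the coefficients at the internal vertices and of the values of `x` at the leaves. -/
noncomputable def treeWeight {R A : Type*} [CommRing R] [CommRing A] [Algebra R A] {d n : ℕ}
    (h : Fin n → (Fin d → Fin n) → R) (x : Fin n → A) : DTree d → Fin n → A
  | .leaf, i => x i
  | .node c, i => ∑ j : Fin d → Fin n, h i j • ∏ l, treeWeight h x (c l) (j l)

theorem map_treeWeight {R A B : Type*} [CommRing R] [CommRing A] [Algebra R A] [CommRing B]
    [Algebra R B] {d n : ℕ} (h : Fin n → (Fin d → Fin n) → R) (x : Fin n → A) (f : A →ₐ[R] B)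
    (T : DTree d) (i : Fin n) :
    f (treeWeight h x T i) = treeWeight h (fun i => f (x i)) T i := by
  induction T generalizing i with
  | leaf => rfl
  | node c ih => simp [treeWeight, map_sum, map_prod, ih]

theorem isHomogeneous_treeWeight {R : Type*} [CommRing R] {d n : ℕ} (hd : 1 ≤ d)
    (h : Fin n → (Fin d → Fin n) → R) (T : DTree d) (i : Fin n) :
    (treeWeight h MvPolynomial.X T i : MvPolynomial (Fin n) R).IsHomogeneous
      ((d - 1) * T.numInternal + 1) := by
  induction T generalizing i with
  | leaf => simpa [treeWeight, DTree.numInternal] using MvPolynomial.isHomogeneous_X R i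
  | node c ih =>
    rw [treeWeight]
    refine MvPolynomial.IsHomogeneous.sum _ _ _ fun j _ => ?_
    rw [MvPolynomial.smul_eq_C_mul]
    refine MvPolynomial.IsHomogeneous.C_mul ?_ _
    convert MvPolynomial.IsHomogeneous.prod Finset.univ _ _ (fun l _ => ih l (j l)) using 1
    rw [Finset.sum_add_distrib, ← Finset.mul_sum, DTree.numInternal]
    simp only [Finset.sum_const, Finset.card_univ, Fintype.card_fin, smul_eq_mul, mul_one]
    obtain ⟨e, rfl⟩ : ∃ e, d = e + 1 := ⟨d - 1, by omega⟩
    rw [Nat.add_sub_cancel]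
    ring

theorem coeff_treeWeight_eq_zero {R : Type*} [CommRing R] {d n : ℕ} (hd : 2 ≤ d)
    (h : Fin n → (Fin d → Fin n) → R) {T : DTree d} {k : ℕ} (hT : T.numInternal ≠ k) (i : Fin n)
    {α : Fin n →₀ ℕ} (hα : α.degree = (d - 1) * k + 1) :
    MvPolynomial.coeff α (treeWeight h MvPolynomial.X T i : MvPolynomial (Fin n) R) = 0 := by
  refine (isHomogeneous_treeWeight (by omega) h T i).coeff_eq_zero ?_
  rw [hα]
  intro h'
  exact hT (Nat.eq_of_mul_eq_mul_left (by omega : 0 < d - 1) (Nat.add_right_cancel h')).symm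

theorem sum_treeWeight_const {R A : Type*} [CommRing R] [CommRing A] [Algebra R A] {d n : ℕ}
    (hd : 1 ≤ d) (c : R) (x : Fin n → A) (T : DTree d) :
    ∑ i, treeWeight (fun _ _ => c) x T i
      = (c * n) ^ T.numInternal • (∑ i, x i) ^ ((d - 1) * T.numInternal + 1) := by
  induction T with
  | leaf => simp [treeWeight, DTree.numInternal]
  | node t ih =>
    have key : ∏ l, ∑ i, treeWeight (fun _ _ => c) x (t l) i
        = (c * n) ^ (∑ l, (t l).numInternal)
          • (∑ i, x i) ^ ((d - 1) * (1 + ∑ l, (t l).numInternal) + 1) := by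
      simp_rw [ih, Finset.prod_smul, Finset.prod_pow_eq_pow_sum, Finset.sum_add_distrib,
        ← Finset.mul_sum]
      congr 2
      simp only [Finset.sum_const, Finset.card_univ, Fintype.card_fin, smul_eq_mul, mul_one]
      obtain ⟨e, rfl⟩ : ∃ e, d = e + 1 := ⟨d - 1, by omega⟩
      rw [Nat.add_sub_cancel]
      ring
    simp only [treeWeight, DTree.numInternal]
    rw [Finset.sum_const, Finset.card_univ, Fintype.card_fin, ← Finset.smul_sum,
      ← Fintype.piFinset_univ, ← Finset.prod_univ_sum, key, smul_smul, ← Nat.cast_smul_eq_nsmul R,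
      smul_smul, pow_add, pow_one]
    congr 1
    ring

theorem treeWeight_const {R A : Type*} [CommRing R] [CommRing A] [Algebra R A] {d n k : ℕ}
    (hd : 1 ≤ d) (c : R) (x : Fin n → A) (T : DTree d) (hT : T.numInternal = k + 1) (i : Fin n) :
    treeWeight (fun _ _ => c) x T i
      = (c ^ (k + 1) * n ^ k) • (∑ i, x i) ^ ((d - 1) * (k + 1) + 1) := by
  rcases T with _ | t
  · simp [DTree.numInternal] at hT
  rw [DTree.numInternal] at hT
  have hk : ∑ l, (t l).numInternal = k := by omega
  simp only [treeWeight]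
  rw [← Finset.smul_sum, ← Fintype.piFinset_univ, ← Finset.prod_univ_sum]
  simp_rw [sum_treeWeight_const hd, Finset.prod_smul, Finset.prod_pow_eq_pow_sum,
    Finset.sum_add_distrib, ← Finset.mul_sum, hk, smul_smul]
  congr 1
  · ring
  · congr 1
    simp only [Finset.sum_const, Finset.card_univ, Fintype.card_fin, smul_eq_mul, mul_one]
    obtain ⟨e, rfl⟩ : ∃ e, d = e + 1 := ⟨d - 1, by omega⟩
    rw [Nat.add_sub_cancel]
    ring

theorem coeff_treeWeight_const {R : Type*} [Field R] [CharZero R] {d n k : ℕ} (hd : 1 ≤ d)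
    (c : R) (T : DTree d) (hT : T.numInternal = k + 1) (i : Fin n) {α : Fin n →₀ ℕ}
    (hα : α.degree = (d - 1) * (k + 1) + 1) :
    MvPolynomial.coeff α
        (treeWeight (fun _ _ => c) MvPolynomial.X T i : MvPolynomial (Fin n) R)
      = c ^ (k + 1) * n ^ k * ((α.degree.factorial : R) / multiFactorial α) := by
  rw [treeWeight_const hd c _ T hT, MvPolynomial.coeff_smul, coeff_sum_X_pow, if_pos hα,
    smul_eq_mul]

/-! ### Coefficientwise domination -/

/-- The coefficients of `f` are bounded in norm by those of `g`. -/
def Dominated {n : ℕ} (f : MvPolynomial (Fin n) ℂ) (g : MvPolynomial (Fin n) ℝ) : Prop :=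
  ∀ α, ‖f.coeff α‖ ≤ g.coeff α

theorem Dominated.mul {n : ℕ} {f f' : MvPolynomial (Fin n) ℂ} {g g' : MvPolynomial (Fin n) ℝ}
    (h : Dominated f g) (h' : Dominated f' g') : Dominated (f * f') (g * g') := by
  intro α
  rw [MvPolynomial.coeff_mul, MvPolynomial.coeff_mul]
  refine (norm_sum_le _ _).trans (Finset.sum_le_sum fun q _ => ?_)
  rw [norm_mul]
  exact mul_le_mul (h _) (h' _) (norm_nonneg _) ((norm_nonneg _).trans (h _))

theorem Dominated.sum {n : ℕ} {ι : Type*} (s : Finset ι) {f : ι → MvPolynomial (Fin n) ℂ}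
    {g : ι → MvPolynomial (Fin n) ℝ} (h : ∀ q ∈ s, Dominated (f q) (g q)) :
    Dominated (∑ q ∈ s, f q) (∑ q ∈ s, g q) := by
  intro α
  rw [MvPolynomial.coeff_sum, MvPolynomial.coeff_sum]
  exact (norm_sum_le _ _).trans (Finset.sum_le_sum fun q hq => h q hq α)

theorem dominated_one {n : ℕ} : Dominated (1 : MvPolynomial (Fin n) ℂ) 1 := by
  classical
  intro α
  rw [MvPolynomial.coeff_one, MvPolynomial.coeff_one]
  split_ifs <;> simp

theorem dominated_X {n : ℕ} (i : Fin n) :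
    Dominated (MvPolynomial.X i : MvPolynomial (Fin n) ℂ) (MvPolynomial.X i) := by
  classical
  intro α
  rw [MvPolynomial.coeff_X, MvPolynomial.coeff_X]
  split_ifs <;> simp

theorem Dominated.prod {n : ℕ} {ι : Type*} (s : Finset ι) {f : ι → MvPolynomial (Fin n) ℂ}
    {g : ι → MvPolynomial (Fin n) ℝ} (h : ∀ q, Dominated (f q) (g q)) :
    Dominated (∏ q ∈ s, f q) (∏ q ∈ s, g q) := by
  classical
  induction s using Finset.induction_on with
  | empty => simpa using dominated_one
  | insert a s ha ih =>
    rw [Finset.prod_insert ha, Finset.prod_insert ha]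
    exact (h a).mul ih

theorem Dominated.smul {n : ℕ} {f : MvPolynomial (Fin n) ℂ} {g : MvPolynomial (Fin n) ℝ}
    (h : Dominated f g) {a : ℂ} {b : ℝ} (hab : ‖a‖ ≤ b) : Dominated (a • f) (b • g) := by
  intro α
  rw [MvPolynomial.coeff_smul, MvPolynomial.coeff_smul, norm_smul]
  exact mul_le_mul hab (h α) (norm_nonneg _) ((norm_nonneg _).trans hab)

theorem dominated_treeWeight {d n : ℕ} {h : Fin n → (Fin d → Fin n) → ℂ} {c : ℝ}
    (hc : ∀ i j, ‖h i j‖ ≤ c) (T : DTree d) (i : Fin n) :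
    Dominated (treeWeight h MvPolynomial.X T i)
      (treeWeight (fun _ _ => c) MvPolynomial.X T i) := by
  induction T generalizing i with
  | leaf => exact dominated_X i
  | node t ih =>
    simp only [treeWeight]
    exact Dominated.sum _ fun j _ => (Dominated.prod _ fun l => ih l (j l)).smul (hc i j)

/-- The bound for the weight of a single tree. -/
noncomputable def treeBound (d n k : ℕ) (α : Fin n →₀ ℕ) (L : ℝ) : ℝ :=
  (L / d.factorial) ^ k * n ^ (k - 1) * ((α.degree.factorial : ℝ) / multiFactorial α)

theorem coeffBound_eq {d : ℕ} (hd : 1 ≤ d) (n k : ℕ) (α : Fin n →₀ ℕ) (L : ℝ) :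
    coeffBound d n k α L = Fintype.card (CatalanTree d k) * treeBound d n k α L := by
  rw [card_catalanTree d hd, coeffBound, treeBound, div_pow]
  ring

theorem norm_coeff_treeWeight_le {d n k : ℕ} (hd : 1 ≤ d) (hk : 1 ≤ k)
    (H : Fin n → MvPolynomial (Fin n) ℂ) (T : CatalanTree d k) (i : Fin n) {α : Fin n →₀ ℕ}
    (hα : α.degree = (d - 1) * k + 1) :
    ‖MvPolynomial.coeff α
        (treeWeight (symCoeff d H) MvPolynomial.X T.1 i : MvPolynomial (Fin n) ℂ)‖
      ≤ treeBound d n k α (maxCoeff d H) := by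
  obtain ⟨k, rfl⟩ : ∃ e, k = e + 1 := ⟨k - 1, by omega⟩
  refine (dominated_treeWeight (norm_symCoeff_le H) T.1 i α).trans_eq ?_
  rw [coeff_treeWeight_const hd _ T.1 T.2 i hα, treeBound, Nat.add_sub_cancel]

/-! ### The extremal map -/

/-- The map all of whose coefficients are equal to `L`. -/
noncomputable def extremal (d n : ℕ) (L : ℂ) : Fin n → MvPolynomial (Fin n) ℂ :=
  fun _ => (L / d.factorial) • (∑ i, MvPolynomial.X i) ^ d

theorem isHomogeneous_extremal (d n : ℕ) (L : ℂ) (i : Fin n) :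
    (extremal d n L i).IsHomogeneous d := by
  rw [extremal, MvPolynomial.smul_eq_C_mul]
  refine MvPolynomial.IsHomogeneous.C_mul ?_ _
  have h := (MvPolynomial.IsHomogeneous.sum Finset.univ
    (fun i : Fin n => (MvPolynomial.X i : MvPolynomial (Fin n) ℂ)) 1
    (fun i _ => MvPolynomial.isHomogeneous_X ℂ i)).pow d
  rwa [one_mul] at h

theorem hcoeff_extremal {d n : ℕ} (L : ℂ) (i : Fin n) {α : Fin n →₀ ℕ} (hα : α.degree = d) :
    hcoeff (extremal d n L) i α = L := by
  have m0 : (multiFactorial α : ℂ) ≠ 0 := by exact_mod_cast multiFactorial_ne_zero α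
  have f0 : (d.factorial : ℂ) ≠ 0 := by exact_mod_cast d.factorial_ne_zero
  rw [hcoeff, extremal, MvPolynomial.coeff_smul, coeff_sum_X_pow, if_pos hα, hα, smul_eq_mul]
  field_simp

theorem symCoeff_extremal (d n : ℕ) (L : ℂ) :
    symCoeff d (extremal d n L) = fun _ _ => L / d.factorial := by
  funext i j
  rw [symCoeff, hcoeff_extremal L i (degree_expo j)]

theorem maxCoeff_extremal (d : ℕ) {n : ℕ} (hn : 1 ≤ n) (L : NNReal) :
    maxCoeff d (extremal d n ((L : ℝ) : ℂ)) = L := by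
  have h : ∀ q ∈ (Finset.univ : Finset (Fin n)) ×ˢ
      Finset.finsuppAntidiag (Finset.univ : Finset (Fin n)) d,
      ‖hcoeff (extremal d n ((L : ℝ) : ℂ)) q.1 q.2‖₊ = L := by
    intro q hq
    rw [Finset.mem_product, Finset.mem_finsuppAntidiag] at hq
    rw [hcoeff_extremal _ _ (by rw [Finsupp.degree_eq_sum]; exact hq.2.1)]
    ext
    simp
  rw [maxCoeff, Finset.sup_congr rfl h, Finset.sup_const]
  refine ⟨(⟨0, hn⟩, Finsupp.single ⟨0, hn⟩ d), ?_⟩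
  rw [Finset.mem_product, Finset.mem_finsuppAntidiag]
  refine ⟨Finset.mem_univ _, ?_, Finset.subset_univ _⟩
  rw [← Finsupp.degree_eq_sum, Finsupp.degree_single]

/-! ### The inverse power series as a sum over trees -/

theorem natCast_le_order_iff {n : ℕ} {f : MvPowerSeries (Fin n) ℂ} {m : ℕ} :
    (m : ℕ∞) ≤ f.order ↔ ∀ α : Fin n →₀ ℕ, α.degree < m → MvPowerSeries.coeff α f = 0 := by
  refine ⟨fun h α hα => MvPowerSeries.coeff_of_lt_order (lt_of_lt_of_le ?_ h),
    fun h => MvPowerSeries.nat_le_order h⟩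
  exact_mod_cast hα

theorem le_order_prod_sub_prod {n m : ℕ} : ∀ {r : ℕ} (x y : Fin r → MvPowerSeries (Fin n) ℂ),
    (∀ l, 1 ≤ (x l).order) → (∀ l, 1 ≤ (y l).order) → (∀ l, (m : ℕ∞) ≤ (x l - y l).order) →
    (m + r : ℕ∞) ≤ (∏ l, x l - ∏ l, y l).order + 1
  | 0, x, y, _, _, _ => by simp
  | r + 1, x, y, hx, hy, hxy => by
    have ih := le_order_prod_sub_prod (fun l : Fin r => x l.succ) (fun l => y l.succ)
      (fun l => hx _) (fun l => hy _) (fun l => hxy _)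
    have hQ : (r : ℕ∞) ≤ (∏ l : Fin r, y l.succ).order := by
      refine le_trans ?_ (MvPowerSeries.le_order_prod _ _)
      refine le_trans ?_ (Finset.sum_le_sum fun l _ => hy l.succ)
      simp
    rw [Fin.prod_univ_succ, Fin.prod_univ_succ]
    have e : x 0 * ∏ l : Fin r, x l.succ - y 0 * ∏ l : Fin r, y l.succ
        = x 0 * (∏ l : Fin r, x l.succ - ∏ l : Fin r, y l.succ)
          + (x 0 - y 0) * ∏ l : Fin r, y l.succ := by ring
    rw [e, Nat.cast_succ, ← add_assoc]
    refine add_le_add_left (le_trans (le_min ?_ ?_) MvPowerSeries.min_order_le_add) 1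
    · refine le_trans ih (le_trans ?_ MvPowerSeries.le_order_mul)
      rw [add_comm]
      exact add_le_add_left (hx 0) _
    · exact le_trans (add_le_add (hxy 0) hQ) MvPowerSeries.le_order_mul

/-- The `d`-homogeneous map with coefficients `h`. -/
noncomputable def homForm {R A : Type*} [CommRing R] [CommRing A] [Algebra R A] {d n : ℕ}
    (h : Fin n → (Fin d → Fin n) → R) (x : Fin n → A) (i : Fin n) : A :=
  ∑ j : Fin d → Fin n, h i j • ∏ l, x (j l)

theorem le_order_homForm_sub {d n m : ℕ} (hd : 2 ≤ d) (h : Fin n → (Fin d → Fin n) → ℂ)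
    {x y : Fin n → MvPowerSeries (Fin n) ℂ} (hx : ∀ i, 1 ≤ (x i).order)
    (hy : ∀ i, 1 ≤ (y i).order) (hxy : ∀ i, (m : ℕ∞) ≤ (x i - y i).order) (i : Fin n) :
    ((m + 1 : ℕ) : ℕ∞) ≤ (homForm h x i - homForm h y i).order := by
  rw [natCast_le_order_iff]
  intro α hα
  rw [homForm, homForm, ← Finset.sum_sub_distrib, map_sum]
  refine Finset.sum_eq_zero fun j _ => ?_
  have h1 := le_order_prod_sub_prod (m := m) (fun l => x (j l)) (fun l => y (j l))
    (fun l => hx _) (fun l => hy _) (fun l => hxy _)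
  have h2 : ((m + 1 : ℕ) : ℕ∞) ≤ (∏ l, x (j l) - ∏ l, y (j l)).order := by
    obtain ⟨e, rfl⟩ : ∃ e, d = e + 1 := ⟨d - 1, by omega⟩
    rw [Nat.cast_succ, ← add_assoc] at h1
    have h3 := (ENat.add_le_add_iff_right ENat.one_ne_top).1 h1
    refine le_trans ?_ h3
    rw [Nat.cast_add]
    have : ((1 : ℕ) : ℕ∞) ≤ e := by exact_mod_cast (by omega : 1 ≤ e)
    gcongr
  rw [← smul_sub, map_smul, natCast_le_order_iff.1 h2 α hα, smul_zero]

theorem sub_homForm_injective {d n : ℕ} (hd : 2 ≤ d) (h : Fin n → (Fin d → Fin n) → ℂ)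
    {x y : Fin n → MvPowerSeries (Fin n) ℂ} (hx : ∀ i, 1 ≤ (x i).order)
    (hy : ∀ i, 1 ≤ (y i).order) (hxy : ∀ i, x i - homForm h x i = y i - homForm h y i) :
    x = y := by
  have key : ∀ m : ℕ, ∀ i, (m : ℕ∞) ≤ (x i - y i).order := by
    intro m
    induction m with
    | zero => simp
    | succ m ih =>
      intro i
      have e : x i - y i = homForm h x i - homForm h y i := by linear_combination hxy i
      rw [e]
      exact le_order_homForm_sub hd h hx hy ih i
  funext i
  rw [← sub_eq_zero]
  ext α
  exact natCast_le_order_iff.1 (key (α.degree + 1) i) α (Nat.lt_succ_self _)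

/-- The sum of the weights of the trees of bounded height. -/
noncomputable def treeApprox {d n : ℕ} (h : Fin n → (Fin d → Fin n) → ℂ) (m : ℕ) (i : Fin n) :
    MvPowerSeries (Fin n) ℂ :=
  ∑ T ∈ treesUpTo d m, treeWeight h MvPowerSeries.X T i

theorem treeApprox_succ {d n : ℕ} (h : Fin n → (Fin d → Fin n) → ℂ) (m : ℕ) (i : Fin n) :
    treeApprox h (m + 1) i = MvPowerSeries.X i + homForm h (treeApprox h m) i := by
  rw [treeApprox, sum_treesUpTo_succ]
  simp only [treeWeight]
  rw [Finset.sum_comm, homForm]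
  congr 1
  refine Finset.sum_congr rfl fun j _ => ?_
  rw [← Finset.smul_sum]
  simp only [treeApprox]
  rw [Finset.prod_univ_sum]

theorem one_le_order_treeApprox {d n : ℕ} (hd : 2 ≤ d) (h : Fin n → (Fin d → Fin n) → ℂ) (m : ℕ)
    (i : Fin n) : 1 ≤ (treeApprox h m i).order := by
  rw [MvPowerSeries.one_le_order_iff_constCoeff_eq_zero]
  induction m generalizing i with
  | zero => simp [treeApprox, treesUpTo]
  | succ m ih =>
    rw [treeApprox_succ, map_add, MvPowerSeries.constantCoeff_X, zero_add, homForm, map_sum]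
    refine Finset.sum_eq_zero fun j _ => ?_
    rw [MvPowerSeries.constantCoeff_smul, map_prod,
      Finset.prod_eq_zero (Finset.mem_univ ⟨0, by omega⟩) (ih _), smul_zero]

theorem le_order_sub_treeApprox {d n : ℕ} (hd : 2 ≤ d) (h : Fin n → (Fin d → Fin n) → ℂ)
    {x : Fin n → MvPowerSeries (Fin n) ℂ} (hx : ∀ i, 1 ≤ (x i).order)
    (hs : ∀ i, x i - homForm h x i = MvPowerSeries.X i) (m : ℕ) (i : Fin n) :
    (m : ℕ∞) ≤ (x i - treeApprox h m i).order := by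
  induction m generalizing i with
  | zero => simp
  | succ m ih =>
    have e : x i - treeApprox h (m + 1) i = homForm h x i - homForm h (treeApprox h m) i := by
      rw [treeApprox_succ]
      linear_combination hs i
    rw [e]
    exact le_order_homForm_sub hd h hx (one_le_order_treeApprox hd h m) ih i

theorem le_order_treeApprox_sub {d n : ℕ} (hd : 2 ≤ d) (h : Fin n → (Fin d → Fin n) → ℂ)
    (m q : ℕ) (i : Fin n) :
    (m : ℕ∞) ≤ (treeApprox h (m + q) i - treeApprox h m i).order := by
  induction m generalizing i with
  | zero => simp
  | succ m ih =>
    rw [Nat.add_right_comm, treeApprox_succ, treeApprox_succ, add_sub_add_left_eq_sub]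
    exact le_order_homForm_sub hd h (one_le_order_treeApprox hd h _)
      (one_le_order_treeApprox hd h m) ih i

theorem exists_sub_homForm_eq_X {d n : ℕ} (hd : 2 ≤ d) (h : Fin n → (Fin d → Fin n) → ℂ) :
    ∃ x : Fin n → MvPowerSeries (Fin n) ℂ, (∀ i, 1 ≤ (x i).order) ∧
      ∀ i, x i - homForm h x i = MvPowerSeries.X i := by
  let x : Fin n → MvPowerSeries (Fin n) ℂ :=
    fun i α => MvPowerSeries.coeff α (treeApprox h (α.degree + 1) i)
  have hcoeff : ∀ i α, MvPowerSeries.coeff α (x i)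
      = MvPowerSeries.coeff α (treeApprox h (α.degree + 1) i) := fun _ _ => rfl
  have happrox : ∀ m i, ((m : ℕ) : ℕ∞) ≤ (x i - treeApprox h m i).order := by
    intro m i
    rw [natCast_le_order_iff]
    intro α hα
    obtain ⟨q, rfl⟩ := Nat.exists_eq_add_of_le (Nat.succ_le_of_lt hα)
    have := natCast_le_order_iff.1 (le_order_treeApprox_sub hd h (α.degree + 1) q i) α
      (Nat.lt_succ_self _)
    rw [map_sub, hcoeff, ← neg_sub, ← map_sub, this, neg_zero]
  have hx : ∀ i, 1 ≤ (x i).order := by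
    intro i
    rw [MvPowerSeries.one_le_order_iff_constCoeff_eq_zero,
      ← MvPowerSeries.coeff_zero_eq_constantCoeff_apply, hcoeff,
      MvPowerSeries.coeff_zero_eq_constantCoeff_apply,
      ← MvPowerSeries.one_le_order_iff_constCoeff_eq_zero]
    exact one_le_order_treeApprox hd h _ i
  refine ⟨x, hx, fun i => ?_⟩
  ext α
  have h1 := natCast_le_order_iff.1 (happrox (α.degree + 1 + 1) i) α (by omega)
  have h2 := natCast_le_order_iff.1 (le_order_homForm_sub hd h hx
    (one_le_order_treeApprox hd h _) (happrox (α.degree + 1)) i) α (by omega)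
  rw [treeApprox_succ] at h1
  rw [map_sub] at h1 h2 ⊢
  rw [map_add] at h1
  linear_combination h1 - h2

theorem coe_treeWeight {d n : ℕ} (h : Fin n → (Fin d → Fin n) → ℂ) (T : DTree d) (i : Fin n) :
    ((treeWeight h MvPolynomial.X T i : MvPolynomial (Fin n) ℂ) : MvPowerSeries (Fin n) ℂ)
      = treeWeight h MvPowerSeries.X T i := by
  have := map_treeWeight h (MvPolynomial.X : Fin n → MvPolynomial (Fin n) ℂ)
    (MvPolynomial.coeToMvPowerSeries.algHom (σ := Fin n) (R := ℂ) ℂ) T i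
  simpa using this

theorem coeff_eq_sum_treeWeight {d n k : ℕ} (hd : 2 ≤ d) (h : Fin n → (Fin d → Fin n) → ℂ)
    {x : Fin n → MvPowerSeries (Fin n) ℂ} (hx : ∀ i, 1 ≤ (x i).order)
    (hs : ∀ i, x i - homForm h x i = MvPowerSeries.X i) (i : Fin n) {α : Fin n →₀ ℕ}
    (hα : α.degree = (d - 1) * k + 1) :
    MvPowerSeries.coeff α (x i) = ∑ T : CatalanTree d k,
      MvPolynomial.coeff α (treeWeight h MvPolynomial.X T.1 i : MvPolynomial (Fin n) ℂ) := by
  have h1 := natCast_le_order_iff.1 (le_order_sub_treeApprox hd h hx hs (α.degree + 1) i) α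
    (Nat.lt_succ_self _)
  rw [map_sub, sub_eq_zero] at h1
  have hk : k < α.degree + 1 := by
    have : 1 * k ≤ (d - 1) * k := Nat.mul_le_mul_right _ (by omega)
    omega
  rw [h1, sum_catalanTree hk (fun T => MvPolynomial.coeff α
    (treeWeight h MvPolynomial.X T i : MvPolynomial (Fin n) ℂ))
    (fun T hT => coeff_treeWeight_eq_zero hd h hT i hα), treeApprox, map_sum]
  refine Finset.sum_congr rfl fun T _ => ?_
  rw [← coe_treeWeight, MvPolynomial.coeff_coe]

/-! ### Inverses of `I - H` -/

theorem aeval_idSub {d n : ℕ} {H : Fin n → MvPolynomial (Fin n) ℂ}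
    (hH : ∀ i, (H i).IsHomogeneous d) {A : Type*} [CommRing A] [Algebra ℂ A] (x : Fin n → A)
    (i : Fin n) :
    MvPolynomial.aeval x (idSub H i) = x i - homForm (symCoeff d H) x i := by
  rw [idSub, map_sub, MvPolynomial.aeval_X, aeval_eq_sum_symCoeff hH, homForm]

theorem IsInverse.one_le_order {n : ℕ} {F : Fin n → MvPolynomial (Fin n) ℂ}
    {G : Fin n → MvPowerSeries (Fin n) ℂ} (hG : IsInverse F G) (i : Fin n) : 1 ≤ (G i).order :=
  MvPowerSeries.one_le_order_iff_constCoeff_eq_zero.2 (hG.1 i)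

theorem IsInverse.sub_homForm {d n : ℕ} {H : Fin n → MvPolynomial (Fin n) ℂ}
    (hH : ∀ i, (H i).IsHomogeneous d) {G : Fin n → MvPowerSeries (Fin n) ℂ}
    (hG : IsInverse (idSub H) G) (i : Fin n) :
    G i - homForm (symCoeff d H) G i = MvPowerSeries.X i := by
  rw [← aeval_idSub hH, hG.2.1]

theorem IsInverse.coeff_eq {d n k : ℕ} (hd : 2 ≤ d) {H : Fin n → MvPolynomial (Fin n) ℂ}
    (hH : ∀ i, (H i).IsHomogeneous d) {G : Fin n → MvPowerSeries (Fin n) ℂ}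
    (hG : IsInverse (idSub H) G) (i : Fin n) {α : Fin n →₀ ℕ}
    (hα : α.degree = (d - 1) * k + 1) :
    MvPowerSeries.coeff α (G i) = ∑ T : CatalanTree d k, MvPolynomial.coeff α
      (treeWeight (symCoeff d H) MvPolynomial.X T.1 i : MvPolynomial (Fin n) ℂ) :=
  coeff_eq_sum_treeWeight hd _ hG.one_le_order (hG.sub_homForm hH) i hα

theorem constantCoeff_idSub {d n : ℕ} (hd : 2 ≤ d) {H : Fin n → MvPolynomial (Fin n) ℂ}
    (hH : ∀ i, (H i).IsHomogeneous d) (i : Fin n) :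
    MvPowerSeries.constantCoeff (idSub H i : MvPowerSeries (Fin n) ℂ) = 0 := by
  rw [← MvPowerSeries.coeff_zero_eq_constantCoeff_apply, MvPolynomial.coeff_coe, idSub,
    MvPolynomial.coeff_sub, MvPolynomial.coeff_zero_X, zero_sub, neg_eq_zero]
  refine (hH i).coeff_eq_zero ?_
  rw [map_zero]
  omega

theorem existsUnique_isInverse {d n : ℕ} (hd : 2 ≤ d) {H : Fin n → MvPolynomial (Fin n) ℂ}
    (hH : ∀ i, (H i).IsHomogeneous d) : ∃! G, IsInverse (idSub H) G := by
  obtain ⟨x, hx, hs⟩ := exists_sub_homForm_eq_X hd (symCoeff d H)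
  have hc : ∀ i, MvPowerSeries.constantCoeff (x i) = 0 := fun i =>
    MvPowerSeries.one_le_order_iff_constCoeff_eq_zero.1 (hx i)
  have hF := MvPowerSeries.hasSubst_of_constantCoeff_zero (constantCoeff_idSub hd hH)
  refine ⟨x, ⟨hc, fun i => by rw [aeval_idSub hH, hs], fun i => ?_⟩, fun G hG => ?_⟩
  · have key : (fun i => MvPowerSeries.subst
        (fun j => (idSub H j : MvPowerSeries (Fin n) ℂ)) (x i))
        = (MvPowerSeries.X : Fin n → MvPowerSeries (Fin n) ℂ) := by
      refine sub_homForm_injective hd (symCoeff d H) (fun i => ?_) (fun i => ?_) fun i => ?_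
      · rw [MvPowerSeries.one_le_order_iff_constCoeff_eq_zero]
        exact MvPowerSeries.constantCoeff_subst_eq_zero hF (constantCoeff_idSub hd hH) (hc i)
      · rw [MvPowerSeries.one_le_order_iff_constCoeff_eq_zero, MvPowerSeries.constantCoeff_X]
      · have h1 := congrArg (MvPowerSeries.substAlgHom (R := ℂ) hF) (hs i)
        rw [map_sub, MvPowerSeries.substAlgHom_X, homForm] at h1
        simp only [map_sum, map_smul, map_prod, MvPowerSeries.substAlgHom_apply] at h1
        rw [homForm, h1, ← aeval_idSub hH, ← MvPowerSeries.subst_coe,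
          MvPowerSeries.subst_self, id]
    exact congrFun key i
  · refine sub_homForm_injective hd (symCoeff d H) hG.one_le_order hx fun i => ?_
    rw [hs, hG.sub_homForm hH]

/-! ### Vanishing of the weights along shuffle classes -/

/-- Ryser's formula for a permanent. -/
theorem sum_perm_prod_eq {A Q : Type*} [CommRing A] [Fintype Q] [DecidableEq Q] (g : Q → Q → A) :
    ∑ σ : Equiv.Perm Q, ∏ q, g q (σ q)
      = ∑ U : Finset Q, (-1) ^ U.card * ∏ q, ∑ t ∈ Uᶜ, g q t := by
  have h1 : ∀ U : Finset Q, (-1 : A) ^ U.card * ∏ q, ∑ t ∈ Uᶜ, g q t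
      = ∑ f : Q → Q, (if U ⊆ (Finset.univ.image f)ᶜ then (-1 : A) ^ U.card else 0)
          * ∏ q, g q (f q) := by
    intro U
    rw [Finset.prod_univ_sum, Finset.mul_sum]
    simp_rw [ite_mul, zero_mul]
    rw [← Finset.sum_filter]
    refine Finset.sum_congr ?_ fun _ _ => rfl
    ext f
    simp only [Fintype.mem_piFinset, Finset.mem_compl, Finset.mem_filter, Finset.mem_univ,
      true_and]
    constructor
    · intro h t ht
      rw [Finset.mem_compl, Finset.mem_image]
      rintro ⟨q, _, rfl⟩
      exact h q ht
    · intro h q hq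
      have := h hq
      rw [Finset.mem_compl] at this
      exact this (Finset.mem_image_of_mem f (Finset.mem_univ q))
  have h2 : ∀ f : Q → Q,
      ∑ U : Finset Q, (if U ⊆ (Finset.univ.image f)ᶜ then (-1 : A) ^ U.card else 0)
        = if Function.Bijective f then 1 else 0 := by
    intro f
    rw [← Finset.sum_filter]
    have e : (Finset.univ.filter fun U : Finset Q => U ⊆ (Finset.univ.image f)ᶜ)
        = (Finset.univ.image f)ᶜ.powerset := by ext; simp
    have h3 := congrArg (Int.cast : ℤ → A)
      (Finset.sum_powerset_neg_one_pow_card (x := (Finset.univ.image f)ᶜ))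
    push_cast at h3
    rw [e, h3]
    congr 1
    rw [Finset.compl_eq_empty_iff, ← Finite.surjective_iff_bijective, Finset.eq_univ_iff_forall,
      eq_iff_iff]
    simp [Function.Surjective]
  simp_rw [h1]
  rw [Finset.sum_comm]
  simp_rw [← Finset.sum_mul, h2, ite_mul, one_mul, zero_mul]
  rw [← Finset.sum_filter]
  refine Finset.sum_bij (fun σ _ => σ) ?_ ?_ ?_ ?_
  · intro σ _
    simp
  · intro σ _ τ _ h
    exact DFunLike.coe_injective h
  · intro f hf
    exact ⟨Equiv.ofBijective f (Finset.mem_filter.1 hf).2, Finset.mem_univ _, rfl⟩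
  · intros; rfl

section PathOperator

variable {R A : Type*} [CommRing R] [CommRing A] [Algebra R A] {d n : ℕ}

/-- The product of the coefficients along a path whose `l`-th vertex has its children labelled
by `J l`, times the value of `z` at the label of the last vertex. -/
noncomputable def pathCoeff (h : Fin n → (Fin d → Fin n) → R) :
    {p : ℕ} → (Fin p → Fin d) → (Fin p → Fin d → Fin n) → (Fin n → A) → Fin n → A
  | 0, _, _, z, i => z i
  | _ + 1, a, J, z, i =>
      h i (J 0) • pathCoeff h (fun l => a l.succ) (fun l => J l.succ) z (J 0 (a 0))

/-- The weight of a path with given weights `y` of its siblings and `z` of its last vertex. -/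
noncomputable def pathWeight (h : Fin n → (Fin d → Fin n) → R) {p : ℕ} (a : Fin p → Fin d)
    (y : Slot a → Fin n → A) (z : Fin n → A) (i : Fin n) : A :=
  ∑ J : Fin p → Fin d → Fin n, (∏ s : Slot a, y s (J s.1.1 s.1.2)) * pathCoeff h a J z i

theorem pathWeight_succ (h : Fin n → (Fin d → Fin n) → R) {p : ℕ} (a : Fin (p + 1) → Fin d)
    (y : Slot a → Fin n → A) (z : Fin n → A) (i : Fin n) :
    pathWeight h a y z i = ∑ j : Fin d → Fin n, h i j •
      ((∏ l, if hl : l ≠ a 0 then y ⟨(0, l), hl⟩ (j l) else 1)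
        * pathWeight h (fun l => a l.succ) (fun s => y ⟨(s.1.1.succ, s.1.2), s.2⟩) z
          (j (a 0))) := by
  rw [pathWeight, ← (Fin.consEquiv fun _ => Fin d → Fin n).sum_comp, Fintype.sum_prod_type]
  refine Finset.sum_congr rfl fun j _ => ?_
  rw [pathWeight, Finset.mul_sum, Finset.smul_sum]
  refine Finset.sum_congr rfl fun J _ => ?_
  rw [prod_slot_succ]
  simp only [Fin.consEquiv_apply, Fin.cons_zero, Fin.cons_succ, pathCoeff]
  rw [mul_smul_comm, mul_assoc]

theorem prod_dite_ne_mul (b : Fin d) (f : (l : Fin d) → l ≠ b → A) (v : A) :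
    (∏ l, if hl : l ≠ b then f l hl else 1) * v = ∏ l, if hl : l = b then v else f l hl := by
  rw [← Finset.mul_prod_erase _ _ (Finset.mem_univ b),
    ← Finset.mul_prod_erase _ (fun l => if hl : l = b then v else f l hl) (Finset.mem_univ b),
    dif_neg (by simp), dif_pos rfl, one_mul, mul_comm]
  congr 1
  refine Finset.prod_congr rfl fun l hl => ?_
  have := Finset.ne_of_mem_erase hl
  rw [dif_pos this, dif_neg this]

theorem treeWeight_spine (h : Fin n → (Fin d → Fin n) → R) (x : Fin n → A) :
    ∀ {p : ℕ} (a : Fin p → Fin d) (W : Slot a → DTree d) (B : DTree d) (i : Fin n),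
    treeWeight h x (DTree.spine a W B) i
      = pathWeight h a (fun s => treeWeight h x (W s)) (treeWeight h x B) i
  | 0, a, W, B, i => by simp [DTree.spine, pathWeight, pathCoeff]
  | p + 1, a, W, B, i => by
    rw [pathWeight_succ, DTree.spine, treeWeight]
    refine Finset.sum_congr rfl fun j _ => ?_
    rw [prod_dite_ne_mul]
    congr 1
    refine Finset.prod_congr rfl fun l _ => ?_
    split_ifs with hl
    · subst hl
      exact treeWeight_spine h x _ _ _ _
    · rfl

theorem pathCoeff_sum {ι : Type*} (s : Finset ι) (h : Fin n → (Fin d → Fin n) → R) :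
    ∀ {p : ℕ} (a : Fin p → Fin d) (J : Fin p → Fin d → Fin n) (z : ι → Fin n → A) (i : Fin n),
    pathCoeff h a J (fun i => ∑ q ∈ s, z q i) i = ∑ q ∈ s, pathCoeff h a J (z q) i
  | 0, _, _, _, _ => rfl
  | p + 1, a, J, z, i => by
    simp only [pathCoeff]
    rw [pathCoeff_sum s, Finset.smul_sum]

theorem pathWeight_sum {ι : Type*} (s : Finset ι) (h : Fin n → (Fin d → Fin n) → R) {p : ℕ}
    (a : Fin p → Fin d) (y : Slot a → Fin n → A) (z : ι → Fin n → A) (i : Fin n) :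
    pathWeight h a y (fun i => ∑ q ∈ s, z q i) i = ∑ q ∈ s, pathWeight h a y (z q) i := by
  simp only [pathWeight]
  rw [Finset.sum_comm]
  refine Finset.sum_congr rfl fun J _ => ?_
  rw [pathCoeff_sum, Finset.mul_sum]

theorem sum_perm_pathWeight (h : Fin n → (Fin d → Fin n) → R) {p : ℕ} (a : Fin p → Fin d)
    (y : Slot a → Fin n → A) (z : Fin n → A) (i : Fin n) :
    ∑ σ : Equiv.Perm (Slot a), pathWeight h a (fun s => y (σ s)) z i
      = ∑ U : Finset (Slot a), (-1) ^ U.card *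
          pathWeight h a (fun _ => ∑ t ∈ Uᶜ, y t) z i := by
  simp only [pathWeight]
  simp_rw [Finset.mul_sum]
  rw [Finset.sum_comm, Finset.sum_comm (s := (Finset.univ : Finset (Finset (Slot a))))]
  refine Finset.sum_congr rfl fun J _ => ?_
  rw [← Finset.sum_mul, sum_perm_prod_eq (fun s t => y t (J s.1.1 s.1.2)), Finset.sum_mul]
  refine Finset.sum_congr rfl fun U _ => ?_
  simp only [Finset.sum_apply, mul_assoc]

end PathOperator

theorem derivation_prod {R A ι : Type*} [CommRing R] [CommRing A] [Algebra R A] [DecidableEq ι]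
    (D : Derivation R A A) (s : Finset ι) (f : ι → A) :
    D (∏ l ∈ s, f l) = ∑ l ∈ s, (∏ q ∈ s.erase l, f q) * D (f l) := by
  induction s using Finset.induction_on with
  | empty => simp
  | insert b s hb ih =>
    rw [Finset.prod_insert hb, Derivation.leibniz, ih, Finset.sum_insert hb,
      Finset.erase_insert hb, smul_eq_mul, smul_eq_mul, Finset.mul_sum, add_comm]
    congr 1
    refine Finset.sum_congr rfl fun l hl => ?_
    have hbl : b ≠ l := fun h => hb (h ▸ hl)
    rw [Finset.erase_insert_of_ne hbl, Finset.prod_insert (fun h => hb (Finset.mem_of_mem_erase h)),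
      mul_assoc]

section Jacobian

variable {A : Type*} [CommRing A] [Algebra ℂ A] {d n : ℕ} {H : Fin n → MvPolynomial (Fin n) ℂ}

theorem aeval_jacobian_mulVec (hH : ∀ i, (H i).IsHomogeneous d) (x f : Fin n → A) (i : Fin n)
    (b : Fin d) :
    ((jacobian H).map (MvPolynomial.aeval x)).mulVec f i
      = (d : ℂ) • ∑ j : Fin d → Fin n, symCoeff d H i j •
          ((∏ l ∈ Finset.univ.erase b, x (j l)) * f (j b)) := by
  have h1 : ∀ i', MvPolynomial.aeval x (MvPolynomial.pderiv i' (H i))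
      = ∑ j : Fin d → Fin n, symCoeff d H i j •
        ∑ l, (∏ q ∈ Finset.univ.erase l, x (j q)) * (if j l = i' then 1 else 0) := by
    intro i'
    conv_lhs => rw [eq_sum_symCoeff hH i]
    rw [map_sum, map_sum]
    refine Finset.sum_congr rfl fun j _ => ?_
    rw [Derivation.map_smul, map_smul, derivation_prod, map_sum]
    congr 1
    refine Finset.sum_congr rfl fun l _ => ?_
    rw [map_mul, map_prod, MvPolynomial.pderiv_X, Pi.single_apply]
    simp only [MvPolynomial.aeval_X]
    congr 1
    split_ifs <;> simp_all
  have h2 : ((jacobian H).map (MvPolynomial.aeval x)).mulVec f i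
      = ∑ l : Fin d, ∑ j : Fin d → Fin n, symCoeff d H i j •
          ((∏ q ∈ Finset.univ.erase l, x (j q)) * f (j l)) := by
    rw [Matrix.mulVec, dotProduct]
    simp only [Matrix.map_apply, jacobian, Matrix.of_apply, h1, Finset.sum_mul]
    rw [Finset.sum_comm, Finset.sum_comm (γ := Fin d)]
    refine Finset.sum_congr rfl fun j _ => ?_
    simp_rw [smul_mul_assoc, ← Finset.smul_sum, Finset.sum_mul]
    rw [Finset.sum_comm]
    congr 1
    refine Finset.sum_congr rfl fun l _ => ?_
    rw [Finset.sum_eq_single (j l)]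
    · simp
    · intro i' _ hi'
      simp [hi'.symm]
    · simp
  have h3 : ∀ l : Fin d, ∑ j : Fin d → Fin n, symCoeff d H i j •
          ((∏ q ∈ Finset.univ.erase l, x (j q)) * f (j l))
      = ∑ j : Fin d → Fin n, symCoeff d H i j •
          ((∏ q ∈ Finset.univ.erase b, x (j q)) * f (j b)) := by
    intro l
    rw [← (Equiv.arrowCongr (Equiv.swap l b) (Equiv.refl (Fin n))).sum_comp]
    refine Finset.sum_congr rfl fun j _ => ?_
    have e : (Equiv.arrowCongr (Equiv.swap l b) (Equiv.refl (Fin n))) j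
        = j ∘ Equiv.swap l b := by
      funext q
      simp [Equiv.arrowCongr]
    rw [e, symCoeff_comp_perm]
    congr 1
    simp only [Function.comp_apply, Equiv.swap_apply_left]
    congr 1
    refine Finset.prod_bij (fun q _ => Equiv.swap l b q) ?_ ?_ ?_ ?_
    · intro q hq
      rw [Finset.mem_erase] at hq ⊢
      refine ⟨fun h => hq.1 ?_, Finset.mem_univ _⟩
      exact (Equiv.swap l b).injective (h.trans (Equiv.swap_apply_left l b).symm)
    · intro q _ q' _ h
      exact (Equiv.swap l b).injective h
    · intro q hq
      rw [Finset.mem_erase] at hq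
      refine ⟨Equiv.swap l b q, ?_, by simp⟩
      rw [Finset.mem_erase]
      refine ⟨fun h => hq.1 ?_, Finset.mem_univ _⟩
      exact (Equiv.swap l b).injective (h.trans (Equiv.swap_apply_right l b).symm)
    · intros; rfl
  rw [h2, Finset.sum_congr rfl fun l _ => h3 l, Finset.sum_const, Finset.card_univ,
    Fintype.card_fin, Nat.cast_smul_eq_nsmul]

theorem pow_smul_pathWeight_const (hH : ∀ i, (H i).IsHomogeneous d) (x z : Fin n → A) :
    ∀ {p : ℕ} (a : Fin p → Fin d) (i : Fin n),
    ((d : ℂ) ^ p) • pathWeight (symCoeff d H) a (fun _ => x) z i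
      = (((jacobian H).map (MvPolynomial.aeval x)) ^ p).mulVec z i
  | 0, a, i => by simp [pathWeight, pathCoeff]
  | p + 1, a, i => by
    have ih := fun i => pow_smul_pathWeight_const hH x z (fun l => a l.succ) i
    rw [pow_succ' (Matrix.map _ _), ← Matrix.mulVec_mulVec, ← funext ih,
      aeval_jacobian_mulVec hH x _ i (a 0), pathWeight_succ, pow_succ', mul_smul]
    congr 1
    rw [Finset.smul_sum]
    refine Finset.sum_congr rfl fun j _ => ?_
    rw [smul_comm, mul_smul_comm]
    congr 3
    rw [← Finset.mul_prod_erase _ _ (Finset.mem_univ (a 0)), dif_neg (by simp), one_mul]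
    refine Finset.prod_congr rfl fun l hl => ?_
    rw [dif_pos (Finset.ne_of_mem_erase hl)]

theorem sum_perm_treeWeight_spine {p : ℕ} (hd : 1 ≤ d) (hH : ∀ i, (H i).IsHomogeneous d)
    (hJ : jacobian H ^ p = 0) (x : Fin n → A) (a : Fin p → Fin d) (W : Slot a → DTree d)
    (B : DTree d) (i : Fin n) :
    ∑ σ : Equiv.Perm (Slot a),
      treeWeight (symCoeff d H) x (DTree.spine a (fun s => W (σ s)) B) i = 0 := by
  simp_rw [treeWeight_spine]
  rw [sum_perm_pathWeight (symCoeff d H) a (fun s => treeWeight (symCoeff d H) x (W s))]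
  refine Finset.sum_eq_zero fun U _ => ?_
  have hd0 : ((d : ℂ) ^ p) ≠ 0 := pow_ne_zero _ (by
    have : d ≠ 0 := by omega
    exact_mod_cast this)
  have h1 := pow_smul_pathWeight_const hH (∑ t ∈ Uᶜ, treeWeight (symCoeff d H) x (W t))
    (treeWeight (symCoeff d H) x B) a i
  have h2 : ((jacobian H).map
      (MvPolynomial.aeval (∑ t ∈ Uᶜ, treeWeight (symCoeff d H) x (W t)))) ^ p = 0 := by
    have := map_pow (AlgHom.mapMatrix (m := Fin n)
      (MvPolynomial.aeval (R := ℂ) (∑ t ∈ Uᶜ, treeWeight (symCoeff d H) x (W t))))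
      (jacobian H) p
    rw [hJ, map_zero] at this
    exact this.symm
  rw [h2, Matrix.zero_mulVec, Pi.zero_apply] at h1
  have h3 := congrArg (fun v => ((d : ℂ) ^ p)⁻¹ • v) h1
  simp only [smul_smul, inv_mul_cancel₀ hd0, one_smul, smul_zero] at h3
  rw [h3, mul_zero]

theorem sum_perm_treeWeight_spine_spine {m p : ℕ} (hd : 1 ≤ d)
    (hH : ∀ i, (H i).IsHomogeneous d) (hJ : jacobian H ^ p = 0) (x : Fin n → A)
    (u : Fin m → Fin d) (V : Slot u → DTree d) (a : Fin p → Fin d) (W : Slot a → DTree d)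
    (B : DTree d) (i : Fin n) :
    ∑ σ : Equiv.Perm (Slot a), treeWeight (symCoeff d H) x
      (DTree.spine u V (DTree.spine a (fun s => W (σ s)) B)) i = 0 := by
  simp_rw [treeWeight_spine _ _ u]
  rw [← pathWeight_sum]
  simp_rw [sum_perm_treeWeight_spine hd hH hJ x a W B]
  have := pathWeight_sum (ι := Empty) ∅ (symCoeff d H) u
    (fun s => treeWeight (symCoeff d H) x (V s)) (fun _ _ => (0 : A)) i
  simpa using this

end Jacobian

/-- The permutations that induce a given rearrangement of a family form a coset. -/
theorem card_filter_comp_perm {Q β : Type*} [Fintype Q] [DecidableEq Q] [DecidableEq β]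
    (W : Q → β) (σ : Equiv.Perm Q) :
    (Finset.univ.filter fun τ : Equiv.Perm Q => W ∘ τ = W ∘ σ).card
      = (Finset.univ.filter fun τ : Equiv.Perm Q => W ∘ τ = W).card := by
  refine Finset.card_bij (fun τ _ => τ * σ⁻¹) ?_ ?_ ?_
  · intro τ hτ
    rw [Finset.mem_filter] at hτ ⊢
    refine ⟨Finset.mem_univ _, ?_⟩
    funext q
    have := congrFun hτ.2 (σ⁻¹ q)
    simpa using this
  · intro τ _ τ' _ h
    exact mul_right_cancel h
  · intro τ hτ
    rw [Finset.mem_filter] at hτ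
    refine ⟨τ * σ, ?_, by simp⟩
    rw [Finset.mem_filter]
    refine ⟨Finset.mem_univ _, ?_⟩
    funext q
    exact congrFun hτ.2 (σ q)

theorem sum_shuffleClass_eq_zero {d n k p : ℕ} {H : Fin n → MvPolynomial (Fin n) ℂ} (hd : 1 ≤ d)
    (hH : ∀ i, (H i).IsHomogeneous d) (hJ : jacobian H ^ p = 0) {S : Set (CatalanTree d k)}
    (hS : IsShuffleClass p S) (i : Fin n) (α : Fin n →₀ ℕ) :
    ∑ T : CatalanTree d k, S.indicator (fun _ => (1 : ℂ)) T * MvPolynomial.coeff α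
      (treeWeight (symCoeff d H) MvPolynomial.X T.1 i : MvPolynomial (Fin n) ℂ) = 0 := by
  classical
  obtain ⟨m, u, V, a, W, B, hk, hSeq⟩ := hS
  have hσ : ∀ σ : Equiv.Perm (Slot a),
      (DTree.spine u V (DTree.spine a (fun s => W (σ s)) B)).numInternal = k := by
    intro σ
    rw [← hk]
    simp only [numInternal_spine]
    rw [Equiv.sum_comp σ (fun s => (W s).numInternal)]
  let Ψ : Equiv.Perm (Slot a) → CatalanTree d k := fun σ => ⟨_, hσ σ⟩
  have hΨ : ∀ σ τ, Ψ σ = Ψ τ ↔ W ∘ σ = W ∘ τ := by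
    intro σ τ
    constructor
    · intro h
      have h1 := congrArg Subtype.val h
      exact (spine_injective _ (spine_injective _ h1).2).1
    · intro h
      refine Subtype.ext ?_
      change DTree.spine u V (DTree.spine a (W ∘ σ) B)
        = DTree.spine u V (DTree.spine a (W ∘ τ) B)
      rw [h]
  have hmem : ∀ T, T ∈ S ↔ ∃ σ, Ψ σ = T := by
    intro T
    rw [hSeq]
    exact exists_congr fun σ => ⟨fun h => Subtype.ext h.symm, fun h => h ▸ rfl⟩
  set w : CatalanTree d k → ℂ := fun T => MvPolynomial.coeff α
      (treeWeight (symCoeff d H) MvPolynomial.X T.1 i : MvPolynomial (Fin n) ℂ) with hw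
  set N := (Finset.univ.filter fun τ : Equiv.Perm (Slot a) => W ∘ τ = W).card with hN
  have hN0 : (N : ℂ) ≠ 0 := by
    have : N ≠ 0 := Finset.card_ne_zero.2 ⟨1, by simp⟩
    exact_mod_cast this
  have h0 : ∑ σ, w (Ψ σ) = 0 := by
    have := congrArg (MvPolynomial.coeff α) (sum_perm_treeWeight_spine_spine hd hH hJ
      (MvPolynomial.X : Fin n → MvPolynomial (Fin n) ℂ) u V a W B i)
    rw [MvPolynomial.coeff_sum, MvPolynomial.coeff_zero] at this
    exact this
  have h1 : ∑ σ, w (Ψ σ) = ∑ T : CatalanTree d k,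
      N * (S.indicator (fun _ => (1 : ℂ)) T * w T) := by
    rw [← Finset.sum_fiberwise (s := Finset.univ) (g := Ψ)]
    refine Finset.sum_congr rfl fun T _ => ?_
    rw [Finset.sum_congr rfl (g := fun _ => w T)
      (fun σ hσ => by rw [(Finset.mem_filter.1 hσ).2]), Finset.sum_const, nsmul_eq_mul]
    by_cases hT : ∃ σ, Ψ σ = T
    · obtain ⟨σ, rfl⟩ := hT
      rw [Set.indicator_of_mem ((hmem _).2 ⟨σ, rfl⟩), one_mul]
      simp_rw [hΨ]
      rw [card_filter_comp_perm]
    · rw [Set.indicator_of_notMem (fun h => hT ((hmem T).1 h)), zero_mul, mul_zero,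
        Finset.filter_false_of_mem]
      · simp
      · exact fun σ _ h => hT ⟨σ, h⟩
  rw [h0, ← Finset.mul_sum] at h1
  exact (mul_eq_zero.1 h1.symm).resolve_left hN0

theorem sum_mem_shuffleSpan_eq_zero {d n k p : ℕ} {H : Fin n → MvPolynomial (Fin n) ℂ}
    (hd : 1 ≤ d) (hH : ∀ i, (H i).IsHomogeneous d) (hJ : jacobian H ^ p = 0)
    {φ : CatalanTree d k → ℂ} (hφ : φ ∈ shuffleSpan d k p) (i : Fin n) (α : Fin n →₀ ℕ) :
    ∑ T : CatalanTree d k, φ T * MvPolynomial.coeff α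
      (treeWeight (symCoeff d H) MvPolynomial.X T.1 i : MvPolynomial (Fin n) ℂ) = 0 := by
  induction hφ using Submodule.span_induction with
  | mem f hf =>
    obtain ⟨S, hS, rfl⟩ := hf
    exact sum_shuffleClass_eq_zero hd hH hJ hS i α
  | zero => simp
  | add f g _ _ hf hg => simp [add_mul, Finset.sum_add_distrib, hf, hg]
  | smul c f _ hf => simp [mul_assoc, ← Finset.mul_sum, hf]

/-! ### Keller maps have nilpotent Jacobians -/

theorem aeval_X_mul_of_isHomogeneous {n m : ℕ} {f : MvPolynomial (Fin n) ℂ}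
    (hf : f.IsHomogeneous m) :
    MvPolynomial.aeval (fun i : Fin n => (Polynomial.X : Polynomial (MvPolynomial (Fin n) ℂ))
        * Polynomial.C (MvPolynomial.X i)) f
      = Polynomial.X ^ m * Polynomial.C f := by
  conv_rhs => rw [← MvPolynomial.support_sum_monomial_coeff f]
  rw [MvPolynomial.aeval_def, MvPolynomial.eval₂_eq', map_sum, Finset.mul_sum]
  refine Finset.sum_congr rfl fun α hα => ?_
  have hdeg : ∑ i, α i = m := by
    rw [← Finsupp.degree_eq_sum]
    by_contra h
    exact MvPolynomial.mem_support_iff.1 hα (hf.coeff_eq_zero h)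
  simp_rw [mul_pow]
  rw [Finset.prod_mul_distrib, Finset.prod_pow_eq_pow_sum, hdeg, MvPolynomial.monomial_eq,
    Finsupp.prod_fintype _ _ (fun _ => pow_zero _), Polynomial.C_mul, map_prod]
  simp only [map_pow]
  rw [mul_left_comm]
  rfl

theorem jacobian_idSub {n : ℕ} (H : Fin n → MvPolynomial (Fin n) ℂ) :
    jacobian (idSub H) = 1 - jacobian H := by
  ext i j : 2
  rw [jacobian, Matrix.of_apply, idSub, map_sub, MvPolynomial.pderiv_X, Matrix.sub_apply,
    Matrix.one_apply, Pi.single_apply]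
  rfl

theorem charpoly_jacobian_eq {d n : ℕ} (hd : 2 ≤ d) {H : Fin n → MvPolynomial (Fin n) ℂ}
    (hH : ∀ i, (H i).IsHomogeneous d) (hK : IsKeller (idSub H)) :
    (jacobian H).charpoly = Polynomial.X ^ n := by
  obtain ⟨c, -, hc⟩ := hK
  have h1 : Polynomial.expand _ (d - 1) (jacobian H).charpolyRev
      = Polynomial.C (MvPolynomial.C c) := by
    have h2 := congrArg (MvPolynomial.aeval (R := ℂ) (fun i : Fin n =>
      (Polynomial.X : Polynomial (MvPolynomial (Fin n) ℂ)) * Polynomial.C (MvPolynomial.X i))) hc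
    rw [jacobian_idSub, AlgHom.map_det, MvPolynomial.aeval_C] at h2
    rw [Matrix.charpolyRev, AlgHom.map_det]
    refine Eq.trans (congrArg Matrix.det ?_) h2
    ext i j : 2
    have h3 := aeval_X_mul_of_isHomogeneous ((hH i).pderiv (i := j))
    simp only [AlgHom.mapMatrix_apply, Matrix.map_apply, Matrix.sub_apply, Matrix.smul_apply,
      map_sub, smul_eq_mul, map_mul, Polynomial.expand_X, Polynomial.expand_C]
    rw [show jacobian H i j = MvPolynomial.pderiv j (H i) from rfl, h3]
    congr 1
    by_cases hij : i = j
    · subst hij; simp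
    · simp [Matrix.one_apply_ne hij]
  have h2 : (jacobian H).charpolyRev = Polynomial.C (MvPolynomial.C c) := by
    rw [← Polynomial.expand_C (d - 1)] at h1
    exact Polynomial.expand_injective (by omega) h1
  have h3 : (jacobian H).charpolyRev = 1 := by
    have h4 := Matrix.eval_charpolyRev (M := jacobian H)
    rw [h2, Polynomial.eval_C] at h4
    rw [h2, h4, Polynomial.C_1]
  rw [← Matrix.reverse_charpoly, Polynomial.reverse, Matrix.charpoly_natDegree_eq_dim,
    Fintype.card_fin] at h3
  have h4 := congrArg (Polynomial.reflect n) h3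
  rw [Polynomial.reflect_reflect] at h4
  rw [h4, Polynomial.reflect_one]

theorem jacobian_pow_eq_zero {d n : ℕ} (hd : 2 ≤ d) {H : Fin n → MvPolynomial (Fin n) ℂ}
    (hH : ∀ i, (H i).IsHomogeneous d) (hK : IsKeller (idSub H)) : jacobian H ^ n = 0 := by
  have h := Matrix.aeval_self_charpoly (jacobian H)
  rwa [charpoly_jacobian_eq hd hH hK, map_pow, Polynomial.aeval_X] at h

/-! ### The bounds -/

theorem treeBound_nonneg {d n k : ℕ} (α : Fin n →₀ ℕ) {L : ℝ} (hL : 0 ≤ L) :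
    0 ≤ treeBound d n k α L := by
  unfold treeBound
  positivity

theorem card_mul_norm1 {d k : ℕ} (f : CatalanTree d k → ℂ) :
    Fintype.card (CatalanTree d k) * norm1 f = ∑ T, ‖f T‖ := by
  rw [norm1]
  rcases isEmpty_or_nonempty (CatalanTree d k) with h | h
  · simp
  · exact mul_div_cancel₀ _ (by exact_mod_cast Fintype.card_ne_zero)

variable {d n k : ℕ} {H : Fin n → MvPolynomial (Fin n) ℂ} {G : Fin n → MvPowerSeries (Fin n) ℂ}

theorem norm_coeff_inverse_le (hd : 2 ≤ d) (hH : ∀ i, (H i).IsHomogeneous d)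
    (hG : IsInverse (idSub H) G) (hk : 1 ≤ k) (i : Fin n) {α : Fin n →₀ ℕ}
    (hα : α.degree = (d - 1) * k + 1) :
    ‖MvPowerSeries.coeff α (G i)‖ ≤ coeffBound d n k α (maxCoeff d H) := by
  rw [hG.coeff_eq hd hH i hα, coeffBound_eq (by omega)]
  refine (norm_sum_le _ _).trans ((Finset.sum_le_card_nsmul _ _ _ fun T _ =>
    norm_coeff_treeWeight_le (by omega) hk H T i hα).trans_eq ?_)
  rw [Finset.card_univ, nsmul_eq_mul]

theorem norm_coeff_inverse_extremal (hd : 2 ≤ d) (L : NNReal)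
    (hG : IsInverse (idSub (extremal d n ((L : ℝ) : ℂ))) G) (hk : 1 ≤ k) (i : Fin n)
    {α : Fin n →₀ ℕ} (hα : α.degree = (d - 1) * k + 1) :
    ‖MvPowerSeries.coeff α (G i)‖ = coeffBound d n k α L := by
  rw [hG.coeff_eq hd (isHomogeneous_extremal d n _) i hα, coeffBound_eq (by omega),
    symCoeff_extremal]
  obtain ⟨k, rfl⟩ : ∃ e, k = e + 1 := ⟨k - 1, by omega⟩
  rw [Finset.sum_congr rfl fun T _ => coeff_treeWeight_const (by omega) _ T.1 T.2 i hα,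
    Finset.sum_const, Finset.card_univ, nsmul_eq_mul]
  have e : (Fintype.card (CatalanTree d (k + 1)) : ℂ)
      * ((((L : ℝ) : ℂ) / d.factorial) ^ (k + 1) * n ^ k
        * ((α.degree.factorial : ℂ) / multiFactorial α))
      = ((Fintype.card (CatalanTree d (k + 1)) * treeBound d n (k + 1) α L : ℝ) : ℂ) := by
    rw [treeBound, Nat.add_sub_cancel]
    push_cast
    rfl
  rw [e, Complex.norm_real, Real.norm_of_nonneg]
  exact mul_nonneg (Nat.cast_nonneg _) (treeBound_nonneg α L.2)

theorem norm_coeff_inverse_le_of_mem_shuffleSpan {p : ℕ} (hd : 2 ≤ d)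
    (hH : ∀ i, (H i).IsHomogeneous d) (hJ : jacobian H ^ p = 0) (hG : IsInverse (idSub H) G)
    (hk : 1 ≤ k) {φ : CatalanTree d k → ℂ} (hφ : φ ∈ shuffleSpan d k p) (i : Fin n)
    {α : Fin n →₀ ℕ} (hα : α.degree = (d - 1) * k + 1) :
    ‖MvPowerSeries.coeff α (G i)‖
      ≤ coeffBound d n k α (maxCoeff d H) * norm1 (fun T => φ T - 1) := by
  have h0 := sum_mem_shuffleSpan_eq_zero (by omega) hH hJ hφ i α
  have h1 : ‖MvPowerSeries.coeff α (G i)‖ = ‖∑ T : CatalanTree d k, (φ T - 1) *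
      MvPolynomial.coeff α
        (treeWeight (symCoeff d H) MvPolynomial.X T.1 i : MvPolynomial (Fin n) ℂ)‖ := by
    simp_rw [sub_mul, one_mul]
    rw [Finset.sum_sub_distrib, h0, zero_sub, norm_neg, hG.coeff_eq hd hH i hα]
  rw [h1, coeffBound_eq (by omega), mul_right_comm, card_mul_norm1, Finset.sum_mul]
  refine (norm_sum_le _ _).trans (Finset.sum_le_sum fun T _ => ?_)
  rw [norm_mul]
  exact mul_le_mul_of_nonneg_left (norm_coeff_treeWeight_le (by omega) hk H T i hα)
    (norm_nonneg _)

theorem coeffBound_nonneg (hd : 1 ≤ d) (α : Fin n →₀ ℕ) (L : NNReal) :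
    0 ≤ coeffBound d n k α L := by
  rw [coeffBound_eq hd]
  exact mul_nonneg (Nat.cast_nonneg _) (treeBound_nonneg α L.2)

end KellerTree

theorem theorem4p4 (d : ℕ) (hd : 2 ≤ d) :
    -- the power series inverse exists and is unique
    (∀ (n : ℕ) (H : Fin n → MvPolynomial (Fin n) ℂ), (∀ i, (H i).IsHomogeneous d) →
      ∃! G : Fin n → MvPowerSeries (Fin n) ℂ, KellerTree.IsInverse (KellerTree.idSub H) G) ∧
    -- the general bound
    (∀ (n : ℕ) (H : Fin n → MvPolynomial (Fin n) ℂ), (∀ i, (H i).IsHomogeneous d) →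
      ∀ G : Fin n → MvPowerSeries (Fin n) ℂ, KellerTree.IsInverse (KellerTree.idSub H) G →
      ∀ (k : ℕ), 1 ≤ k → ∀ (i : Fin n) (α : Fin n →₀ ℕ), α.degree = (d - 1) * k + 1 →
        ‖MvPowerSeries.coeff α (G i)‖
          ≤ KellerTree.coeffBound d n k α (KellerTree.maxCoeff d H)) ∧
    -- its sharpness, for every dimension and every value of `L`
    (∀ (n : ℕ), 1 ≤ n → ∀ L : NNReal,
      ∃ H : Fin n → MvPolynomial (Fin n) ℂ, (∀ i, (H i).IsHomogeneous d) ∧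
        KellerTree.maxCoeff d H = L ∧
        ∀ G : Fin n → MvPowerSeries (Fin n) ℂ, KellerTree.IsInverse (KellerTree.idSub H) G →
        ∀ (k : ℕ), 1 ≤ k → ∀ (i : Fin n) (α : Fin n →₀ ℕ), α.degree = (d - 1) * k + 1 →
          ‖MvPowerSeries.coeff α (G i)‖ = KellerTree.coeffBound d n k α L) ∧
    -- the bound for nilpotent Jacobians, for every function in the span of shuffle indicators
    (∀ (p : ℕ), 1 ≤ p →
      ∀ (n : ℕ) (H : Fin n → MvPolynomial (Fin n) ℂ), (∀ i, (H i).IsHomogeneous d) →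
      (KellerTree.jacobian H) ^ p = 0 →
      ∀ G : Fin n → MvPowerSeries (Fin n) ℂ, KellerTree.IsInverse (KellerTree.idSub H) G →
      ∀ (k : ℕ), 1 ≤ k → ∀ φ ∈ KellerTree.shuffleSpan d k p,
      ∀ (i : Fin n) (α : Fin n →₀ ℕ), α.degree = (d - 1) * k + 1 →
        ‖MvPowerSeries.coeff α (G i)‖
          ≤ KellerTree.coeffBound d n k α (KellerTree.maxCoeff d H)
            * KellerTree.norm1 (fun T => φ T - 1)) ∧
    -- the exponential improvement; `C` and `c` depend on `d` and `p` only
    (∀ (p : ℕ), 1 ≤ p → ∃ C c : ℝ, 0 < C ∧ 0 < c ∧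
      (∀ (k : ℕ), 1 ≤ k → ∃ φ ∈ KellerTree.shuffleSpan d k p,
        KellerTree.norm1 (fun T => φ T - 1) ≤ C * Real.exp (-c * k)) ∧
      (∀ (n : ℕ) (H : Fin n → MvPolynomial (Fin n) ℂ), (∀ i, (H i).IsHomogeneous d) →
        (KellerTree.jacobian H) ^ p = 0 →
        ∀ G : Fin n → MvPowerSeries (Fin n) ℂ, KellerTree.IsInverse (KellerTree.idSub H) G →
        ∀ (k : ℕ), 1 ≤ k → ∀ (i : Fin n) (α : Fin n →₀ ℕ), α.degree = (d - 1) * k + 1 →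
          ‖MvPowerSeries.coeff α (G i)‖
            ≤ KellerTree.coeffBound d n k α (KellerTree.maxCoeff d H)
              * (C * Real.exp (-c * k)))) ∧
    -- hence for Keller maps; here `C` and `c` depend on `d` and `n` only
    (∀ (n : ℕ), ∃ C c : ℝ, 0 < C ∧ 0 < c ∧
      ∀ H : Fin n → MvPolynomial (Fin n) ℂ, (∀ i, (H i).IsHomogeneous d) →
        KellerTree.IsKeller (KellerTree.idSub H) →
        ∀ G : Fin n → MvPowerSeries (Fin n) ℂ, KellerTree.IsInverse (KellerTree.idSub H) G →
        ∀ (k : ℕ), 1 ≤ k → ∀ (i : Fin n) (α : Fin n →₀ ℕ), α.degree = (d - 1) * k + 1 →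
          ‖MvPowerSeries.coeff α (G i)‖
            ≤ KellerTree.coeffBound d n k α (KellerTree.maxCoeff d H)
              * (C * Real.exp (-c * k))) := by
  have improved : ∀ p : ℕ, 1 ≤ p → ∃ C c : ℝ, 0 < C ∧ 0 < c ∧
      (∀ (k : ℕ), 1 ≤ k → ∃ φ ∈ KellerTree.shuffleSpan d k p,
        KellerTree.norm1 (fun T => φ T - 1) ≤ C * Real.exp (-c * k)) ∧
      (∀ (n : ℕ) (H : Fin n → MvPolynomial (Fin n) ℂ), (∀ i, (H i).IsHomogeneous d) →
        (KellerTree.jacobian H) ^ p = 0 →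
        ∀ G : Fin n → MvPowerSeries (Fin n) ℂ, KellerTree.IsInverse (KellerTree.idSub H) G →
        ∀ (k : ℕ), 1 ≤ k → ∀ (i : Fin n) (α : Fin n →₀ ℕ), α.degree = (d - 1) * k + 1 →
          ‖MvPowerSeries.coeff α (G i)‖
            ≤ KellerTree.coeffBound d n k α (KellerTree.maxCoeff d H)
              * (C * Real.exp (-c * k))) := by
    intro p hp
    obtain ⟨C, c, hC, hc, h⟩ := KellerTree.exists_mem_shuffleSpan_norm1_le hd hp
    refine ⟨C, c, hC, hc, h, fun n H hH hJ G hG k hk i α hα => ?_⟩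
    obtain ⟨φ, hφ, hle⟩ := h k hk
    exact (KellerTree.norm_coeff_inverse_le_of_mem_shuffleSpan hd hH hJ hG hk hφ i hα).trans
      (mul_le_mul_of_nonneg_left hle (KellerTree.coeffBound_nonneg (by omega) α _))
  refine ⟨fun n H hH => KellerTree.existsUnique_isInverse hd hH,
    fun n H hH G hG k hk i α hα => KellerTree.norm_coeff_inverse_le hd hH hG hk i hα,
    fun n hn L => ⟨KellerTree.extremal d n ((L : ℝ) : ℂ),
      KellerTree.isHomogeneous_extremal d n _, KellerTree.maxCoeff_extremal d hn L,
      fun G hG k hk i α hα => KellerTree.norm_coeff_inverse_extremal hd L hG hk i hα⟩,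
    fun p _ n H hH hJ G hG k hk φ hφ i α hα =>
      KellerTree.norm_coeff_inverse_le_of_mem_shuffleSpan hd hH hJ hG hk hφ i hα,
    improved, fun n => ?_⟩
  obtain ⟨C, c, hC, hc, -, h⟩ := improved (n + 1) (by omega)
  refine ⟨C, c, hC, hc, fun H hH hK => h n H hH ?_⟩
  rw [pow_succ, KellerTree.jacobian_pow_eq_zero hd hH hK, zero_mul]
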